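/- **Partial Horn theories.** A partial Horn theory consists of a set of sorts, function symbols $\sigma:s_1\times\dots\times s_k\to s$, predicate symbols $R:s_1\times\dots\times s_k$, and a set of sequents $\varphi\vdash_V\psi$, where $V$ is a finite set of sorted variables and $\varphi,\psi$ are finite conjunctions of atomic formulas $t=t'$ or $R(t_1,\dots,t_k)$ with variables in $V$; $t\!\downarrow$ abbreviates $t=t$. A model $M$ consists of sets $M_s$, partial functions $M(\sigma)$ and relations $M(R)$ such that all the sequents hold, where an equation $t=t'$ holds when both sides are defined and equal. A morphism of models is a family of total functions $\alpha_s:M_s\to N_s$ which preserves the relations and satisfies: if $M(\sigma)(x_1,\dots,x_k)$ is defined, then $N(\sigma)(\alpha x_1,\dots,\alpha x_k)$ is defined and equals $\alpha(M(\sigma)(x_1,\dots,x_k))$. This gives the category $\mathrm{Mod}(\mathbb T)$ of (small) models. We write $\varphi\vdash_V t\cong s$ for the two sequents $\varphi\wedge t\!\downarrow\,\vdash_V t=s$ and $\varphi\wedge s\!\downarrow\,\vdash_V t=s$. **The theory of substitutions $\mathbb S$.** Its sorts are $(ctx,n)$ and $(tm,n)$ for $n\in\mathbb N$; put $(ty,n)=(ctx,n+1)$.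 It has no predicate symbols, and its function symbols are $$*:(ctx,0),\quad ft_n:(ty,n)\to(ctx,n),\quad ty_n:(tm,n)\to(ty,n),\quad v_{n,i}:(ctx,n)\to(tm,n)\ (0\le i<n),$$ $$subst_{p,n,k}:(ctx,n)\times(p,k)\times(tm,n)^k\to(p,n)\quad(p\in\{tm,ty\}).$$ Derived operations: $ft^0_n(A)=A$, $ft^{i+1}_n(A)=ft^i_n(ft_{n+i}(A))$, $ctx_{ty,n}(A)=ft_n(A)$, $ctx_{tm,n}(a)=ft_n(ty_n(a))$. The formula $Hom_{n,k}(B,A,a_1,\dots,a_k)$, with $B:(ctx,n)$, $A:(ctx,k)$, $a_i:(tm,n)$, is the conjunction over $1\le i\le k$ of $ty_n(a_i)=subst_{ty,n,i-1}(B,ft^{k-i}_i(A),a_1,\dots,a_{i-1})$. The axioms (for all $p$ and all indices) are: 1. $\vdash *\!\downarrow$ and $\vdash_A A=*$ for $A:(ctx,0)$; 2. $\vdash_A v_{n,i}(A)\!\downarrow$; 3. $Hom_{n,k}(B,ctx_{p,k}(a),a_1,\dots,a_k)\vdash subst_{p,n,k}(B,a,a_1,\dots,a_k)\!\downarrow$,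 and the converse sequent; 4. $\vdash_A ty_n(v_{n,i}(A))=subst_{ty,n,n-i-1}(A,ft^i_{n-i}(A),v_{n,n-1}(A),\dots,v_{n,i+1}(A))$; 5. $Hom_{n,k}(B,ft_k(A),a_1,\dots,a_k)\vdash ft_n(subst_{ty,n,k}(B,A,a_1,\dots,a_k))=B$; 6. $\vdash ty_n(subst_{tm,n,k}(B,a,a_1,\dots,a_k))\cong subst_{ty,n,k}(B,ty_k(a),a_1,\dots,a_k)$; 7. $\vdash_a subst_{p,n,n}(ctx_{p,n}(a),a,v_{n,n-1}(ctx_{p,n}(a)),\dots,v_{n,0}(ctx_{p,n}(a)))=a$; 8. $Hom_{n,k}(B,A,a_1,\dots,a_k)\vdash subst_{tm,n,k}(B,v_{k,i}(A),a_1,\dots,a_k)=a_{k-i}$ for $0\le i<k$; 9. $Hom_{n,k}(C,B,b_1,\dots,b_k)\wedge Hom_{k,m}(B,ctx_{p,m}(a),a_1,\dots,a_m)\vdash subst_{p,n,k}(C,subst_{p,k,m}(B,a,a_1,\dots,a_m),b_1,\dots,b_k)=subst_{p,n,m}(C,a,subst_{tm,n,k}(C,a_1,b_1,\dots,b_k),\dots,subst_{tm,n,k}(C,a_m,b_1,\dots,b_k))$.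 **Contextual categories.** A contextual category is a small category whose set of objects is a disjoint union $\coprod_n Ob_n$, where $Ob_0$ has exactly one element and this element is a terminal object, with functions $ft:Ob_{n+1}\to Ob_n$, morphisms $p_A:A\to ft(A)$ for $A\in Ob_{n+1}$, and, for each $A\in Ob_{k+1}$, $B\in Ob_n$ and $f:B\to ft(A)$, an object $f^*(A)\in Ob_{n+1}$ with $ft(f^*(A))=B$ and a morphism $q(f,A):f^*(A)\to A$ such that the square $p_A\circ q(f,A)=f\circ p_{f^*(A)}$ is Cartesian, and such that $id^*(A)=A$, $q(id,A)=id_A$, $(f\circ g)^*(A)=g^*(f^*(A))$, $q(f\circ g,A)=q(f,A)\circ q(g,f^*(A))$. Morphisms of contextual categories are functors which strictly preserve the grading and the operations $ft$, $p$, $f^*$, $q$. The resulting category is $\mathbf{CCat}$. **The construction $F$.** Let $M$ be a model of $\mathbb S$. The contextual category $F(M)$ has $Ob_n=M_{(ctx,n)}$; the morphisms from $B\in M_{(ctx,n)}$ to $A\in M_{(ctx,k)}$ are the tuples $(a_1,\dots,a_k)$ of elements of $M_{(tm,n)}$ such that $Hom_{n,k}(B,A,a_1,\dots,a_k)$ holds.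 For $f=(b_1,\dots,b_n):B\to ctx_{p,n}(a)$ with $B\in M_{(ctx,m)}$ write $a[f]=subst_{p,m,n}(B,a,b_1,\dots,b_n)$. Composition is $(c_1,\dots,c_m)\circ f=(c_1[f],\dots,c_m[f])$, the identity of $A\in M_{(ctx,n)}$ is $(v_{n,n-1}(A),\dots,v_{n,0}(A))$, and for $A \in M_{(ctx,n)}$ with $n\ge 1$, $p_A=(v_{n,n-1}(A),\dots,v_{n,1}(A))$. The function $ft$ is that of $M$, $f^*(A)=A[f]$, and for $f=(a_1,\dots,a_k):B\to ft_k(A)$ the morphism $q(f,A)$ is the tuple $(a_1[p_{A[f]}],\dots,a_k[p_{A[f]}],v_{n+1,0}(A[f]))$. For a morphism of models $\alpha:M\to N$ let $F(\alpha)$ be given by $A\mapsto\alpha(A)$ on objects and by $(a_1,\dots,a_k)\mapsto(\alpha(a_1),\dots,\alpha(a_k))$ on morphisms. **Proposition.** Each $F(\alpha)$ is a morphism of contextual categories $F(M)\to F(N)$, $F$ is a functor $\mathrm{Mod}(\mathbb S)\to\mathbf{CCat}$, and this functor is an equivalence of categories. -/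

import Mathlib

open CategoryTheory

universe w u

/-! ## Partial Horn theories and their models -/

namespace PartialHorn

/-- A many-sorted first-order signature.  Every symbol has a finite family of argument sorts. -/
structure Signature where
  Srt : Type w
  Fn : Type w
  Rel : Type w
  FnArg : Fn → Type
  finite_fnArg : ∀ σ, Finite (FnArg σ)
  fnDom : ∀ σ, FnArg σ → Srt
  fnCod : Fn → Srt
  RelArg : Rel → Type
  finite_relArg : ∀ R, Finite (RelArg R)
  relDom : ∀ R, RelArg R → Srt

/-- A finite set of sorted variables. -/
structure Vars (S : Type w) where
  Var : Type
  finite : Finite Var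
  sort : Var → S

/-- Terms with variables in `V`. -/
inductive Term (Sg : Signature.{w}) (V : Vars Sg.Srt) : Sg.Srt → Type w
  | var (x : V.Var) : Term Sg V (V.sort x)
  | app (σ : Sg.Fn) (t : ∀ i, Term Sg V (Sg.fnDom σ i)) : Term Sg V (Sg.fnCod σ)

/-- Atomic formulas `t₁ = t₂` and `R(t₁, …, tₙ)`. -/
inductive Atomic (Sg : Signature.{w}) (V : Vars Sg.Srt) : Type w
  | eq {s : Sg.Srt} (t₁ t₂ : Term Sg V s) : Atomic Sg V
  | rel (R : Sg.Rel) (t : ∀ i, Term Sg V (Sg.relDom R i)) : Atomic Sg V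

/-- The formula `t↓`, an abbreviation of `t = t`. -/
def Atomic.defined {Sg : Signature.{w}} {V : Vars Sg.Srt} {s : Sg.Srt} (t : Term Sg V s) :
    Atomic Sg V := .eq t t

/-- Horn formulas: finite conjunctions of atomic formulas. -/
abbrev Horn (Sg : Signature.{w}) (V : Vars Sg.Srt) : Type w := List (Atomic Sg V)

/-- Horn sequents `φ ⊢_V ψ`. -/
structure Sequent (Sg : Signature.{w}) where
  vars : Vars Sg.Srt
  hyp : Horn Sg vars
  concl : Horn Sg vars

/-- A partial Horn theory: a signature and a set of Horn sequents. -/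
structure Theory where
  sig : Signature.{w}
  axioms : Set (Sequent sig)

/-- Interpretations of a signature: function symbols are interpreted by partial functions. -/
structure Interpretation (Sg : Signature.{w}) where
  carrier : Sg.Srt → Type u
  fn : ∀ σ : Sg.Fn, (∀ i, carrier (Sg.fnDom σ i)) → Part (carrier (Sg.fnCod σ))
  rel : ∀ R : Sg.Rel, Set (∀ i, carrier (Sg.relDom R i))

namespace Interpretation

variable {Sg : Signature.{w}} (M : Interpretation.{w, u} Sg) {V : Vars Sg.Srt}

/-- The partial value of a term: `σ(t₁, …, tₙ)` is defined when all `tᵢ` are defined and `M(σ)` is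
defined on their values. -/
def eval (ρ : ∀ x, M.carrier (V.sort x)) : ∀ {s : Sg.Srt}, Term Sg V s → Part (M.carrier s)
  | _, .var x => Part.some (ρ x)
  | _, .app σ t =>
    Part.bind ⟨∀ i, (eval ρ (t i)).Dom, fun h i => (eval ρ (t i)).get (h i)⟩ (M.fn σ)

/-- Truth of atomic formulas.  An equation holds when both sides are defined and equal. -/
def SatAtomic (ρ : ∀ x, M.carrier (V.sort x)) : Atomic Sg V → Prop
  | .eq t₁ t₂ => ∃ a, a ∈ M.eval ρ t₁ ∧ a ∈ M.eval ρ t₂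
  | .rel R t => ∃ a, (∀ i, a i ∈ M.eval ρ (t i)) ∧ a ∈ M.rel R

/-- Truth of Horn formulas. -/
def Sat (ρ : ∀ x, M.carrier (V.sort x)) (φ : Horn Sg V) : Prop := ∀ χ ∈ φ, M.SatAtomic ρ χ

/-- Validity of a sequent. -/
def Holds (S : Sequent Sg) : Prop := ∀ ρ, M.Sat (V := S.vars) ρ S.hyp → M.Sat ρ S.concl

end Interpretation

/-- Models of a partial Horn theory. -/
structure Model (T : Theory.{w}) extends Interpretation.{w, u} T.sig where
  holds : ∀ S ∈ T.axioms, toInterpretation.Holds S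

/-- Homomorphisms of models: families of total functions which preserve the (graphs of the)
partial operations and the relations. -/
@[ext]
structure Model.Hom {T : Theory.{w}} (M N : Model.{w, u} T) where
  app : ∀ s, M.carrier s → N.carrier s
  app_fn : ∀ (σ : T.sig.Fn) (x : ∀ i, M.carrier (T.sig.fnDom σ i)) (y : M.carrier (T.sig.fnCod σ)),
    y ∈ M.fn σ x → app _ y ∈ N.fn σ (fun i => app _ (x i))
  app_rel : ∀ (R : T.sig.Rel) (x : ∀ i, M.carrier (T.sig.relDom R i)),
    x ∈ M.rel R → (fun i => app _ (x i)) ∈ N.rel R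

/-- The category of models of a partial Horn theory. -/
instance (T : Theory.{w}) : Category (Model.{w, u} T) where
  Hom := Model.Hom
  id M := ⟨fun _ x => x, fun _ _ _ h => h, fun _ _ h => h⟩
  comp f g := ⟨fun s x => g.app s (f.app s x), fun σ _ _ h => g.app_fn σ _ _ (f.app_fn σ _ _ h),
    fun R _ h => g.app_rel R _ (f.app_rel R _ h)⟩

end PartialHorn

/-! ## The theory of substitutions -/

namespace SubstTheory

open PartialHorn

inductive Kind : Type
  | ctx
  | tm

/-- The index `p ∈ {tm, ty}`. -/
inductive TmTy : Type
  | tm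
  | ty

/-- The sort `(p, n)`, where `(ty, n)` stands for `(ctx, n + 1)`. -/
abbrev TmTy.sort : TmTy → ℕ → Kind × ℕ
  | .tm, n => (.tm, n)
  | .ty, n => (.ctx, n + 1)

inductive Sym : Type
  | star
  | ft (n : ℕ)
  | ty (n : ℕ)
  | v (n : ℕ) (i : Fin n)
  | subst (p : TmTy) (n k : ℕ)

/-- The positions of a list `B, x, a₁, …, aₖ`. -/
inductive Pos (k : ℕ) : Type
  | base
  | body
  | sub (i : Fin k)

theorem Pos.finite (k : ℕ) : Finite (Pos k) :=
  Finite.of_surjective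
    (fun o : Option (Option (Fin k)) => match o with
      | none => Pos.base
      | some none => Pos.body
      | some (some i) => Pos.sub i)
    (fun x => match x with
      | .base => ⟨none, rfl⟩
      | .body => ⟨some none, rfl⟩
      | .sub i => ⟨some (some i), rfl⟩)

/-- The sorts in a list `B : (ctx, n), x : s, a₁ : (tm, n), …, aₖ : (tm, n)`. -/
abbrev Pos.sort (s : Kind × ℕ) (n k : ℕ) : Pos k → Kind × ℕ
  | .base => (.ctx, n)
  | .body => s
  | .sub _ => (.tm, n)

/-- The signature
`* : (ctx, 0)`, `ft n : (ty, n) → (ctx, n)`, `ty n : (tm, n) → (ty, n)`, `v n i : (ctx, n) → (tm, n)`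
for `i < n`, and `subst p n k : (ctx, n) × (p, k) × (tm, n)ᵏ → (p, n)`; no predicate symbols. -/
abbrev sig : Signature.{0} where
  Srt := Kind × ℕ
  Fn := Sym
  Rel := Empty
  FnArg
    | .star => Empty
    | .ft _ => Unit
    | .ty _ => Unit
    | .v _ _ => Unit
    | .subst _ _ k => Pos k
  finite_fnArg
    | .star => inferInstanceAs (Finite Empty)
    | .ft _ => inferInstanceAs (Finite Unit)
    | .ty _ => inferInstanceAs (Finite Unit)
    | .v _ _ => inferInstanceAs (Finite Unit)
    | .subst _ _ k => Pos.finite k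
  fnDom
    | .star => Empty.elim
    | .ft n => fun _ => (.ctx, n + 1)
    | .ty n => fun _ => (.tm, n)
    | .v n _ => fun _ => (.ctx, n)
    | .subst p n k => Pos.sort (p.sort k) n k
  fnCod
    | .star => (.ctx, 0)
    | .ft n => (.ctx, n)
    | .ty n => (.ctx, n + 1)
    | .v n _ => (.tm, n)
    | .subst p n _ => p.sort n
  RelArg := Empty.elim
  finite_relArg := fun R => R.elim
  relDom := fun R => R.elim

section Terms

variable {V : Vars sig.Srt}

def tStar : Term sig V (.ctx, 0) := .app (Sg := sig) Sym.star (fun i => i.elim)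

def tFt {n : ℕ} (A : Term sig V (.ctx, n + 1)) : Term sig V (.ctx, n) :=
  .app (Sg := sig) (Sym.ft n) (fun _ => A)

def tTy {n : ℕ} (a : Term sig V (.tm, n)) : Term sig V (.ctx, n + 1) :=
  .app (Sg := sig) (Sym.ty n) (fun _ => a)

def tV {n : ℕ} (i : Fin n) (A : Term sig V (.ctx, n)) : Term sig V (.tm, n) :=
  .app (Sg := sig) (Sym.v n i) (fun _ => A)

def tSubst (p : TmTy) {n k : ℕ} (B : Term sig V (.ctx, n)) (x : Term sig V (p.sort k))
    (a : Fin k → Term sig V (.tm, n)) : Term sig V (p.sort n) :=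
  .app (Sg := sig) (Sym.subst p n k) (fun i => match i with
    | .base => B
    | .body => x
    | .sub i => a i)

/-- The derived operations `ftⁱₙ : (ctx, n + i) → (ctx, n)`. -/
def tFtIter {n : ℕ} : ∀ i : ℕ, Term sig V (.ctx, n + i) → Term sig V (.ctx, n)
  | 0, A => A
  | i + 1, A => tFtIter i (tFt A)

/-- The derived operations `ctx_{p,n} : (p, n) → (ctx, n)`. -/
def tCtx {n : ℕ} : ∀ p : TmTy, Term sig V (p.sort n) → Term sig V (.ctx, n)
  | .ty, A => tFt A
  | .tm, a => tFt (tTy a)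

/-- The tuple `v_{n,n-1}(A), …, v_{n,n-j}(A)` of length `j ≤ n`. -/
def tVs {n : ℕ} (j : ℕ) (hj : j ≤ n) (A : Term sig V (.ctx, n)) : Fin j → Term sig V (.tm, n) :=
  fun t => tV (Fin.rev (Fin.castLE hj t)) A

/-- The formula `Hom_{n,k}(B, A, a₁, …, aₖ)`, i.e. the conjunction over `1 ≤ i ≤ k` of
`ty_n(aᵢ) = subst_{ty,n,i-1}(B, ft^{k-i}_i(A), a₁, …, a_{i-1})`, listed by recursion on `k`
(note that `ft^{k+1-i}_i(A) = ft^{k-i}_i(ft_k(A))`). -/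
def homFormula {n : ℕ} (B : Term sig V (.ctx, n)) :
    ∀ k : ℕ, Term sig V (.ctx, k) → (Fin k → Term sig V (.tm, n)) → Horn sig V
  | 0, _, _ => []
  | k + 1, A, a => homFormula B k (tFt A) (fun i => a i.castSucc) ++
      [.eq (tTy (a (Fin.last k))) (tSubst .ty B A (fun i => a i.castSucc))]

end Terms

/-- No variables. -/
abbrev noVars : Vars sig.Srt := ⟨Empty, inferInstance, Empty.elim⟩

/-- One variable of sort `s`. -/
abbrev oneVar (s : Kind × ℕ) : Vars sig.Srt := ⟨Unit, inferInstance, fun _ => s⟩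

/-- Variables `B : (ctx, n)`, `x : s`, `a₁, …, aₖ : (tm, n)`. -/
abbrev tupleVars (s : Kind × ℕ) (n k : ℕ) : Vars sig.Srt := ⟨Pos k, Pos.finite k, Pos.sort s n k⟩

/-- Variables `C`, `b₁, …, bₖ`, `B`, `a₁, …, aₘ`, `x`. -/
inductive CompVar (k m : ℕ) : Type
  | C
  | b (i : Fin k)
  | B
  | a (i : Fin m)
  | x

theorem CompVar.finite (k m : ℕ) : Finite (CompVar k m) :=
  Finite.of_surjective
    (fun o : Fin 3 ⊕ Fin k ⊕ Fin m => match o with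
      | .inl 0 => CompVar.C
      | .inl 1 => CompVar.B
      | .inl 2 => CompVar.x
      | .inr (.inl i) => CompVar.b i
      | .inr (.inr i) => CompVar.a i)
    (fun y => match y with
      | .C => ⟨.inl 0, rfl⟩
      | .B => ⟨.inl 1, rfl⟩
      | .x => ⟨.inl 2, rfl⟩
      | .b i => ⟨.inr (.inl i), rfl⟩
      | .a i => ⟨.inr (.inr i), rfl⟩)

/-- Variables `C : (ctx, n)`, `bᵢ : (tm, n)`, `B : (ctx, k)`, `aᵢ : (tm, k)`, `x : (p, m)`. -/
abbrev compVars (p : TmTy) (n k m : ℕ) : Vars sig.Srt :=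
  ⟨CompVar k m, CompVar.finite k m, fun y => match y with
    | .C => (.ctx, n)
    | .b _ => (.tm, n)
    | .B => (.ctx, k)
    | .a _ => (.tm, k)
    | .x => p.sort m⟩

section Variables

def var₁ {s : Kind × ℕ} : Term sig (oneVar s) s :=
  .var (Sg := sig) (V := oneVar s) ()

variable {s : Kind × ℕ} {p : TmTy} {n k m : ℕ}

def varB : Term sig (tupleVars s n k) (.ctx, n) :=
  .var (Sg := sig) (V := tupleVars s n k) Pos.base
def varX : Term sig (tupleVars s n k) s :=
  .var (Sg := sig) (V := tupleVars s n k) Pos.body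
def varA (i : Fin k) : Term sig (tupleVars s n k) (.tm, n) :=
  .var (Sg := sig) (V := tupleVars s n k) (Pos.sub i)

def cvarC : Term sig (compVars p n k m) (.ctx, n) :=
  .var (Sg := sig) (V := compVars p n k m) CompVar.C
def cvarb (i : Fin k) : Term sig (compVars p n k m) (.tm, n) :=
  .var (Sg := sig) (V := compVars p n k m) (CompVar.b i)
def cvarB : Term sig (compVars p n k m) (.ctx, k) :=
  .var (Sg := sig) (V := compVars p n k m) CompVar.B
def cvara (i : Fin m) : Term sig (compVars p n k m) (.tm, k) :=
  .var (Sg := sig) (V := compVars p n k m) (CompVar.a i)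
def cvarx : Term sig (compVars p n k m) (p.sort m) :=
  .var (Sg := sig) (V := compVars p n k m) CompVar.x

end Variables

/-- The axioms of the theory of substitutions. -/
inductive Ax : Sequent sig → Prop
  /-- `⊢ *↓` -/
  | star_def : Ax ⟨noVars, [], [.defined tStar]⟩
  /-- `⊢_A A = *` for `A : (ctx, 0)` -/
  | star_unique : Ax ⟨oneVar (.ctx, 0), [], [.eq var₁ tStar]⟩
  /-- `⊢_A v_{n,i}(A)↓` -/
  | v_def (n : ℕ) (i : Fin n) : Ax ⟨oneVar (.ctx, n), [], [.defined (tV i var₁)]⟩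
  /-- `Hom(B, ctx_p(x), a₁, …, aₖ) ⊢ subst_p(B, x, a₁, …, aₖ)↓` -/
  | subst_def (p : TmTy) (n k : ℕ) : Ax ⟨tupleVars (p.sort k) n k,
      homFormula varB k (tCtx p varX) varA, [.defined (tSubst p varB varX varA)]⟩
  /-- `subst_p(B, x, a₁, …, aₖ)↓ ⊢ Hom(B, ctx_p(x), a₁, …, aₖ)` -/
  | def_subst (p : TmTy) (n k : ℕ) : Ax ⟨tupleVars (p.sort k) n k,
      [.defined (tSubst p varB varX varA)], homFormula varB k (tCtx p varX) varA⟩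
  /-- `⊢_A ty_n(v_{n,i}(A)) = subst_{ty,n,j}(A, ftⁱ(A), v_{n,n-1}(A), …, v_{n,i+1}(A))`,
  where `n = j + 1 + i`, i.e. `j = n - i - 1` -/
  | ty_v (j i : ℕ) : Ax ⟨oneVar (.ctx, j + 1 + i), [],
      [.eq (tTy (tV ⟨i, by omega⟩ var₁))
        (tSubst .ty var₁ (tFtIter i var₁) (tVs j (by omega) var₁))]⟩
  /-- `Hom(B, ft(A), a₁, …, aₖ) ⊢ ft(subst_ty(B, A, a₁, …, aₖ)) = B` -/
  | ft_subst (n k : ℕ) : Ax ⟨tupleVars (TmTy.ty.sort k) n k,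
      homFormula varB k (tFt varX) varA, [.eq (tFt (tSubst .ty varB varX varA)) varB]⟩
  /-- `⊢ ty(subst_tm(B, a, a₁, …, aₖ)) ≅ subst_ty(B, ty(a), a₁, …, aₖ)`, first half -/
  | ty_subst (n k : ℕ) : Ax ⟨tupleVars (TmTy.tm.sort k) n k,
      [.defined (tTy (tSubst .tm varB varX varA))],
      [.eq (tTy (tSubst .tm varB varX varA)) (tSubst .ty varB (tTy varX) varA)]⟩
  /-- second half -/
  | subst_ty (n k : ℕ) : Ax ⟨tupleVars (TmTy.tm.sort k) n k,
      [.defined (tSubst .ty varB (tTy varX) varA)],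
      [.eq (tTy (tSubst .tm varB varX varA)) (tSubst .ty varB (tTy varX) varA)]⟩
  /-- `⊢ subst_{p,n,n}(ctx_p(a), a, v_{n,n-1}(ctx_p(a)), …, v_{n,0}(ctx_p(a))) = a` -/
  | subst_v (p : TmTy) (n : ℕ) : Ax ⟨oneVar (p.sort n), [],
      [.eq (tSubst p (tCtx p var₁) var₁ (tVs n le_rfl (tCtx p var₁))) var₁]⟩
  /-- `Hom(B, A, a₁, …, aₖ) ⊢ subst_tm(B, v_{k,i}(A), a₁, …, aₖ) = a_{k-i}` -/
  | v_subst (n k : ℕ) (i : Fin k) : Ax ⟨tupleVars (.ctx, k) n k,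
      homFormula varB k varX varA, [.eq (tSubst .tm varB (tV i varX) varA) (varA (Fin.rev i))]⟩
  /-- `Hom(C, B, b) ∧ Hom(B, ctx_p(x), a) ⊢
  subst_p(C, subst_p(B, x, a), b) = subst_p(C, x, subst_tm(C, a₁, b), …, subst_tm(C, aₘ, b))` -/
  | subst_subst (p : TmTy) (n k m : ℕ) : Ax ⟨compVars p n k m,
      homFormula cvarC k cvarB cvarb ++ homFormula cvarB m (tCtx p cvarx) cvara,
      [.eq (tSubst p cvarC (tSubst p cvarB cvarx cvara) cvarb)
        (tSubst p cvarC cvarx (fun i => tSubst .tm cvarC (cvara i) cvarb))]⟩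

/-- The theory of substitutions. -/
abbrev 𝕊 : Theory.{0} := ⟨sig, {S | Ax S}⟩

end SubstTheory

/-! ## Contextual categories -/

/-- The total set of a graded set of objects. -/
structure GradedObj (Ob : ℕ → Type u) : Type u where
  of ::
  {level : ℕ}
  obj : Ob level

open GradedObj in
/-- (Small) contextual categories.  To avoid transports, the canonical projection is written as
`p h : A ⟶ B` for `h : ft A = B`, and the canonical pullback of `A` along `f : B ⟶ D` takes
a proof `h : ft A = D`. -/
structure CCat where
  Ob : ℕ → Type u
  [cat : Category.{u} (GradedObj Ob)]
  pt : Ob 0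
  eq_pt : ∀ A : Ob 0, A = pt
  terminal : ∀ X : GradedObj Ob, Nonempty (Unique (X ⟶ of pt))
  ft : ∀ {n : ℕ}, Ob (n + 1) → Ob n
  p : ∀ {n : ℕ} {A : Ob (n + 1)} {B : Ob n}, ft A = B → (of A ⟶ of B)
  /-- the object `f^*(A)` -/
  pb : ∀ {n k : ℕ} {B : Ob n} {D : Ob k} {A : Ob (k + 1)}, ft A = D → (of B ⟶ of D) → Ob (n + 1)
  ft_pb : ∀ {n k : ℕ} {B : Ob n} {D : Ob k} {A : Ob (k + 1)} (h : ft A = D) (f : of B ⟶ of D),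
    ft (pb h f) = B
  q : ∀ {n k : ℕ} {B : Ob n} {D : Ob k} {A : Ob (k + 1)} (h : ft A = D) (f : of B ⟶ of D),
    of (pb h f) ⟶ of A
  isPullback : ∀ {n k : ℕ} {B : Ob n} {D : Ob k} {A : Ob (k + 1)} (h : ft A = D)
    (f : of B ⟶ of D), IsPullback (q h f) (p (ft_pb h f)) (p h) f
  pb_id : ∀ {k : ℕ} {D : Ob k} {A : Ob (k + 1)} (h : ft A = D), pb h (𝟙 (of D)) = A
  q_id : ∀ {k : ℕ} {D : Ob k} {A : Ob (k + 1)} (h : ft A = D),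
    q h (𝟙 (of D)) = eqToHom (congrArg of (pb_id h))
  pb_comp : ∀ {m n k : ℕ} {C : Ob m} {B : Ob n} {D : Ob k} {A : Ob (k + 1)} (h : ft A = D)
    (g : of C ⟶ of B) (f : of B ⟶ of D), pb h (g ≫ f) = pb (ft_pb h f) g
  q_comp : ∀ {m n k : ℕ} {C : Ob m} {B : Ob n} {D : Ob k} {A : Ob (k + 1)} (h : ft A = D)
    (g : of C ⟶ of B) (f : of B ⟶ of D),
    q h (g ≫ f) = eqToHom (congrArg of (pb_comp h g f)) ≫ q (ft_pb h f) g ≫ q h f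

attribute [instance] CCat.cat

namespace CCat

open GradedObj

/-- Morphisms of contextual categories: functors which preserve the levels of objects and all the
structure strictly. -/
@[ext]
structure Hom (C D : CCat.{u}) where
  obj : ∀ {n : ℕ}, C.Ob n → D.Ob n
  map : ∀ {n k : ℕ} {A : C.Ob n} {B : C.Ob k}, (of A ⟶ of B) → (of (obj A) ⟶ of (obj B))
  map_id : ∀ {n : ℕ} (A : C.Ob n), map (𝟙 (of A)) = 𝟙 (of (obj A))
  map_comp : ∀ {m n k : ℕ} {A : C.Ob m} {B : C.Ob n} {E : C.Ob k} (f : of A ⟶ of B)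
    (g : of B ⟶ of E), map (f ≫ g) = map f ≫ map g
  obj_ft : ∀ {n : ℕ} {A : C.Ob (n + 1)} {B : C.Ob n}, C.ft A = B → D.ft (obj A) = obj B
  map_p : ∀ {n : ℕ} {A : C.Ob (n + 1)} {B : C.Ob n} (h : C.ft A = B),
    map (C.p h) = D.p (obj_ft h)
  obj_pb : ∀ {n k : ℕ} {B : C.Ob n} {E : C.Ob k} {A : C.Ob (k + 1)} (h : C.ft A = E)
    (f : of B ⟶ of E), obj (C.pb h f) = D.pb (obj_ft h) (map f)
  map_q : ∀ {n k : ℕ} {B : C.Ob n} {E : C.Ob k} {A : C.Ob (k + 1)} (h : C.ft A = E)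
    (f : of B ⟶ of E),
    map (C.q h f) = eqToHom (congrArg of (obj_pb h f)) ≫ D.q (obj_ft h) (map f)

theorem Hom.map_eqToHom {C D : CCat.{u}} (F : Hom C D) {n : ℕ} {A B : C.Ob n} (h : A = B) :
    F.map (eqToHom (congrArg of h)) = eqToHom (congrArg (fun X => of (F.obj X)) h) := by
  subst h; simpa using F.map_id A

/-- The category of contextual categories. -/
instance : Category CCat.{u} where
  Hom := Hom
  id C :=
    { obj := fun A => A
      map := fun f => f
      map_id := fun _ => rfl
      map_comp := fun _ _ => rfl
      obj_ft := fun h => h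
      map_p := fun _ => rfl
      obj_pb := fun _ _ => rfl
      map_q := fun _ _ => by simp }
  comp F G :=
    { obj := fun A => G.obj (F.obj A)
      map := fun f => G.map (F.map f)
      map_id := fun A => by rw [F.map_id, G.map_id]
      map_comp := fun f g => by rw [F.map_comp, G.map_comp]
      obj_ft := fun h => G.obj_ft (F.obj_ft h)
      map_p := fun h => by rw [F.map_p, G.map_p]
      obj_pb := fun h f => by rw [F.obj_pb, G.obj_pb]
      map_q := fun h f => by
        rw [F.map_q, G.map_comp, G.map_q, G.map_eqToHom (F.obj_pb h f)]
        simp }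

end CCat

/-! ## The contextual category of a model -/

namespace PartialHorn.Interpretation

variable {Sg : Signature.{w}} (M : Interpretation.{w, u} Sg) {V : Vars Sg.Srt}

theorem mem_eval_app (ρ : ∀ x, M.carrier (V.sort x)) (σ : Sg.Fn)
    (t : ∀ i, Term Sg V (Sg.fnDom σ i)) (b : M.carrier (Sg.fnCod σ)) :
    b ∈ M.eval ρ (.app σ t) ↔ ∃ x, (∀ i, x i ∈ M.eval ρ (t i)) ∧ b ∈ M.fn σ x := by
  rw [eval, Part.mem_bind_iff]
  constructor
  · rintro ⟨x, ⟨h, rfl⟩, hb⟩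
    exact ⟨_, fun i => Part.get_mem _, hb⟩
  · rintro ⟨x, hx, hb⟩
    refine ⟨x, ⟨fun i => (hx i).1, ?_⟩, hb⟩
    funext i
    exact (hx i).2

theorem sat_append (ρ : ∀ x, M.carrier (V.sort x)) (φ ψ : Horn Sg V) :
    M.Sat ρ (φ ++ ψ) ↔ M.Sat ρ φ ∧ M.Sat ρ ψ := by
  simp [Sat, or_imp, forall_and]

theorem sat_eq (ρ : ∀ x, M.carrier (V.sort x)) {s : Sg.Srt} (t₁ t₂ : Term Sg V s) :
    M.Sat ρ [.eq t₁ t₂] ↔ ∃ a, a ∈ M.eval ρ t₁ ∧ a ∈ M.eval ρ t₂ := by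
  simp [Sat, SatAtomic]

theorem sat_nil (ρ : ∀ x, M.carrier (V.sort x)) : M.Sat ρ [] := by
  simp [Sat]

end PartialHorn.Interpretation

namespace SubstTheory

open PartialHorn

/-- The arguments `B, x, a₁, …, aₖ` of a substitution operation. -/
def args {X : Kind × ℕ → Type u} {s : Kind × ℕ} {n k : ℕ} (B : X (.ctx, n)) (x : X s)
    (a : Fin k → X (.tm, n)) : ∀ i : Pos k, X (Pos.sort s n k i)
  | .base => B
  | .body => x
  | .sub i => a i

/-- The variables `C, b, B, a, x`. -/
def compArgs {X : Kind × ℕ → Type u} {p : TmTy} {n k m : ℕ} (C : X (.ctx, n))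
    (b : Fin k → X (.tm, n)) (B : X (.ctx, k)) (a : Fin m → X (.tm, k)) (x : X (p.sort m)) :
    ∀ i : CompVar k m, X ((compVars p n k m).sort i)
  | .C => C
  | .b i => b i
  | .B => B
  | .a i => a i
  | .x => x

variable (M : Model.{0, u} 𝕊)

/-- Contexts of length `n` in a model. -/
abbrev Ob (n : ℕ) : Type u := M.carrier (.ctx, n)

/-- Terms in contexts of length `n` in a model. -/
abbrev Tm (n : ℕ) : Type u := M.carrier (.tm, n)

/-- The elements of sort `(p, n)` of a model. -/
abbrev El (p : TmTy) (n : ℕ) : Type u := M.carrier (p.sort n)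

variable {M}

/-- The partial operation `subst_{p,n,k}` of a model. -/
def sub (p : TmTy) {n k : ℕ} (B : Ob M n) (x : El M p k) (a : Fin k → Tm M n) :
    Part (El M p n) := M.fn (Sym.subst p n k) (args (X := M.carrier) B x a)

section Eval

variable {V : Vars sig.Srt} (ρ : ∀ x, M.carrier (V.sort x))

theorem mem_tFt {n : ℕ} (t : Term sig V (.ctx, n + 1)) (b : Ob M n) :
    b ∈ M.eval ρ (tFt t) ↔ ∃ A, A ∈ M.eval ρ t ∧ b ∈ M.fn (Sym.ft n) (fun _ => A) := by
  refine (M.mem_eval_app ρ _ _ _).trans ⟨?_, ?_⟩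
  · rintro ⟨x, h, hb⟩
    exact ⟨x (), h (), hb⟩
  · rintro ⟨A, h, hb⟩
    exact ⟨fun _ => A, fun _ => h, hb⟩

theorem mem_tTy {n : ℕ} (t : Term sig V (.tm, n)) (b : Ob M (n + 1)) :
    b ∈ M.eval ρ (tTy t) ↔ ∃ A, A ∈ M.eval ρ t ∧ b ∈ M.fn (Sym.ty n) (fun _ => A) := by
  refine (M.mem_eval_app ρ _ _ _).trans ⟨?_, ?_⟩
  · rintro ⟨x, h, hb⟩
    exact ⟨x (), h (), hb⟩
  · rintro ⟨A, h, hb⟩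
    exact ⟨fun _ => A, fun _ => h, hb⟩

theorem mem_tV {n : ℕ} (i : Fin n) (t : Term sig V (.ctx, n)) (b : Tm M n) :
    b ∈ M.eval ρ (tV i t) ↔ ∃ A, A ∈ M.eval ρ t ∧ b ∈ M.fn (Sym.v n i) (fun _ => A) := by
  refine (M.mem_eval_app ρ _ _ _).trans ⟨?_, ?_⟩
  · rintro ⟨x, h, hb⟩
    exact ⟨x (), h (), hb⟩
  · rintro ⟨A, h, hb⟩
    exact ⟨fun _ => A, fun _ => h, hb⟩

theorem mem_tSubst (p : TmTy) {n k : ℕ} (tB : Term sig V (.ctx, n)) (tx : Term sig V (p.sort k))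
    (ta : Fin k → Term sig V (.tm, n)) (b : El M p n) :
    b ∈ M.eval ρ (tSubst p tB tx ta) ↔
      ∃ (B : Ob M n) (x : El M p k) (a : Fin k → Tm M n), B ∈ M.eval ρ tB ∧ x ∈ M.eval ρ tx ∧
        (∀ i, a i ∈ M.eval ρ (ta i)) ∧ b ∈ sub p B x a := by
  refine (M.mem_eval_app ρ _ _ _).trans ⟨?_, ?_⟩
  · rintro ⟨y, h, hb⟩
    refine ⟨y .base, y .body, fun i => y (.sub i), h .base, h .body, fun i => h (.sub i), ?_⟩
    have : y = args (X := M.carrier) (y .base) (y .body) (fun i => y (.sub i)) := by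
      funext i; cases i <;> rfl
    unfold sub
    rw [← this]
    exact hb
  · rintro ⟨B, x, a, hB, hx, ha, hb⟩
    refine ⟨args (X := M.carrier) B x a, fun i => ?_, hb⟩
    cases i
    · exact hB
    · exact hx
    · exact ha _

end Eval

/-! Values of variables. -/

theorem eval_var₁ {s : Kind × ℕ} (x : M.carrier s) :
    M.eval (V := oneVar s) (fun _ => x) var₁ = Part.some x := by
  unfold var₁
  rw [Interpretation.eval]

theorem mem_var₁ {s : Kind × ℕ} (x y : M.carrier s) :
    y ∈ M.eval (V := oneVar s) (fun _ => x) var₁ ↔ y = x := by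
  rw [eval_var₁, Part.mem_some_iff]

section

variable {s : Kind × ℕ} {n k : ℕ} (B : Ob M n) (x : M.carrier s) (a : Fin k → Tm M n)

theorem eval_varB : M.eval (V := tupleVars s n k) (args (X := M.carrier) B x a) varB =
    Part.some B := by
  unfold varB
  rw [Interpretation.eval]
  rfl

theorem eval_varX : M.eval (V := tupleVars s n k) (args (X := M.carrier) B x a) varX =
    Part.some x := by
  unfold varX
  rw [Interpretation.eval]
  rfl

theorem eval_varA (i : Fin k) :
    M.eval (V := tupleVars s n k) (args (X := M.carrier) B x a) (varA i) = Part.some (a i) := by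
  unfold varA
  rw [Interpretation.eval]
  rfl

end

/-! Totality of `ft`, `ty`, `v`. -/

theorem ft_dom {n : ℕ} (A : Ob M (n + 1)) : (M.fn (Sym.ft n) (fun _ => A)).Dom := by
  have h := M.holds _ (Ax.subst_v .ty n) (fun _ => A) (M.sat_nil _)
  obtain ⟨y, hy, -⟩ := (M.sat_eq _ _ _).1 h
  obtain ⟨B, x, a, hB, -⟩ := (mem_tSubst _ _ _ _ _ _).1 hy
  obtain ⟨A', hA', hB⟩ := (mem_tFt _ _ _).1 hB
  cases (mem_var₁ A A').1 hA'
  exact hB.1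

/-- The operation `ft` of a model (it is total). -/
def ft {n : ℕ} (A : Ob M (n + 1)) : Ob M n := (M.fn (Sym.ft n) (fun _ => A)).get (ft_dom A)

theorem ty_dom {n : ℕ} (a : Tm M n) : (M.fn (Sym.ty n) (fun _ => a)).Dom := by
  have h := M.holds _ (Ax.subst_v .tm n) (fun _ => a) (M.sat_nil _)
  obtain ⟨y, hy, -⟩ := (M.sat_eq _ _ _).1 h
  obtain ⟨B, x, a', hB, -⟩ := (mem_tSubst _ _ _ _ _ _).1 hy
  obtain ⟨A', hA', hB⟩ := (mem_tFt _ _ _).1 hB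
  obtain ⟨A'', hA'', hB'⟩ := (mem_tTy _ _ _).1 hA'
  cases (mem_var₁ a A'').1 hA''
  exact hB'.1

/-- The operation `ty` of a model (it is total). -/
def ty {n : ℕ} (a : Tm M n) : Ob M (n + 1) := (M.fn (Sym.ty n) (fun _ => a)).get (ty_dom a)

theorem v_dom {n : ℕ} (i : Fin n) (A : Ob M n) : (M.fn (Sym.v n i) (fun _ => A)).Dom := by
  have h := M.holds _ (Ax.v_def n i) (fun _ => A) (M.sat_nil _)
  obtain ⟨y, hy, -⟩ := (M.sat_eq _ _ _).1 h
  obtain ⟨A', hA', hB⟩ := (mem_tV _ _ _ _).1 hy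
  cases (mem_var₁ A A').1 hA'
  exact hB.1

/-- The operation `v_{n,i}` of a model (it is total). -/
def v {n : ℕ} (i : Fin n) (A : Ob M n) : Tm M n := (M.fn (Sym.v n i) (fun _ => A)).get (v_dom i A)

/-- The derived operation `ctx_{p,n}`. -/
def ctxOf {n : ℕ} : ∀ p : TmTy, El M p n → Ob M n
  | .ty, A => ft (n := n) A
  | .tm, a => ft (ty a)

/-- The derived operation `ftⁱₙ`. -/
def ftIter {n : ℕ} : ∀ i : ℕ, Ob M (n + i) → Ob M n
  | 0, A => A
  | i + 1, A => ftIter i (ft A)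

/-- The tuple `v_{n,n-1}(A), …, v_{n,n-j}(A)`. -/
def vs {n : ℕ} (j : ℕ) (hj : j ≤ n) (A : Ob M n) : Fin j → Tm M n :=
  fun t => v (Fin.rev (Fin.castLE hj t)) A

/-- The relation `Hom_{n,k}(B, A, a₁, …, aₖ)` in a model. -/
def IsHom {n : ℕ} (B : Ob M n) : ∀ {k : ℕ}, Ob M k → (Fin k → Tm M n) → Prop
  | 0, _, _ => True
  | k + 1, A, a => IsHom B (ft A) (fun i => a i.castSucc) ∧
      ty (a (Fin.last k)) ∈ sub .ty (k := k) B A (fun i => a i.castSucc)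

section Eval

variable {V : Vars sig.Srt} {ρ : ∀ x, M.carrier (V.sort x)}

theorem eval_tFt {n : ℕ} {t : Term sig V (.ctx, n + 1)} {A : Ob M (n + 1)}
    (h : M.eval ρ t = Part.some A) : M.eval ρ (tFt t) = Part.some (ft A) := by
  ext b
  rw [mem_tFt, h]
  simp only [Part.mem_some_iff, exists_eq_left]
  exact ⟨fun hb => Part.mem_unique hb (Part.get_mem _), fun hb => hb ▸ Part.get_mem _⟩

theorem eval_tTy {n : ℕ} {t : Term sig V (.tm, n)} {a : Tm M n}
    (h : M.eval ρ t = Part.some a) : M.eval ρ (tTy t) = Part.some (ty a) := by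
  ext b
  rw [mem_tTy, h]
  simp only [Part.mem_some_iff, exists_eq_left]
  exact ⟨fun hb => Part.mem_unique hb (Part.get_mem _), fun hb => hb ▸ Part.get_mem _⟩

theorem eval_tV {n : ℕ} (i : Fin n) {t : Term sig V (.ctx, n)} {A : Ob M n}
    (h : M.eval ρ t = Part.some A) : M.eval ρ (tV i t) = Part.some (v i A) := by
  ext b
  rw [mem_tV, h]
  simp only [Part.mem_some_iff, exists_eq_left]
  exact ⟨fun hb => Part.mem_unique hb (Part.get_mem _), fun hb => hb ▸ Part.get_mem _⟩

theorem eval_tVs {n : ℕ} (j : ℕ) (hj : j ≤ n) {t : Term sig V (.ctx, n)} {A : Ob M n}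
    (h : M.eval ρ t = Part.some A) (i : Fin j) :
    M.eval ρ (tVs j hj t i) = Part.some (vs j hj A i) := eval_tV _ h

theorem eval_tCtx {n : ℕ} (p : TmTy) {t : Term sig V (p.sort n)} {x : El M p n}
    (h : M.eval ρ t = Part.some x) : M.eval ρ (tCtx p t) = Part.some (ctxOf p x) := by
  cases p
  · exact eval_tFt (eval_tTy h)
  · exact eval_tFt h

theorem eval_tFtIter {n : ℕ} (i : ℕ) {t : Term sig V (.ctx, n + i)} {A : Ob M (n + i)}
    (h : M.eval ρ t = Part.some A) : M.eval ρ (tFtIter i t) = Part.some (ftIter i A) := by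
  induction i with
  | zero => exact h
  | succ i ih => exact ih (eval_tFt h)

theorem eval_tSubst (p : TmTy) {n k : ℕ} {tB : Term sig V (.ctx, n)} {tx : Term sig V (p.sort k)}
    {ta : Fin k → Term sig V (.tm, n)} {B : Ob M n} {x : El M p k} {a : Fin k → Tm M n}
    (hB : M.eval ρ tB = Part.some B) (hx : M.eval ρ tx = Part.some x)
    (ha : ∀ i, M.eval ρ (ta i) = Part.some (a i)) :
    M.eval ρ (tSubst p tB tx ta) = sub p B x a := by
  ext b
  rw [mem_tSubst]
  simp only [hB, hx, ha, Part.mem_some_iff]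
  constructor
  · rintro ⟨B', x', a', rfl, rfl, h, hb⟩
    obtain rfl : a' = a := funext h
    exact hb
  · intro hb
    exact ⟨B, x, a, rfl, rfl, fun _ => rfl, hb⟩

/-- `IsHom` is the interpretation of the formula `Hom`. -/
theorem sat_homFormula {n k : ℕ} {tB : Term sig V (.ctx, n)} {tA : Term sig V (.ctx, k)}
    {ta : Fin k → Term sig V (.tm, n)} {B : Ob M n} {A : Ob M k} {a : Fin k → Tm M n}
    (hB : M.eval ρ tB = Part.some B) (hA : M.eval ρ tA = Part.some A)
    (ha : ∀ i, M.eval ρ (ta i) = Part.some (a i)) :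
    M.Sat ρ (homFormula tB k tA ta) ↔ IsHom B A a := by
  induction k with
  | zero => exact iff_of_true (M.sat_nil _) trivial
  | succ k ih =>
    rw [homFormula, M.sat_append, M.sat_eq, IsHom]
    refine and_congr (ih (eval_tFt hA) fun i => ha _) ?_
    rw [eval_tTy (ha _), eval_tSubst .ty hB hA (fun i => ha _)]
    simp [Part.mem_some_iff]

end Eval

/-! The axioms, semantically. -/

theorem eq_pt (A B : Ob M 0) : A = B := by
  have key : ∀ A : Ob M 0, A ∈ M.fn Sym.star (fun i => i.elim) := by
    intro A
    have h := M.holds _ Ax.star_unique (fun _ => A) (M.sat_nil _)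
    obtain ⟨y, hy, hs⟩ := (M.sat_eq _ _ _).1 h
    cases (mem_var₁ A y).1 hy
    obtain ⟨x, -, hb⟩ := (M.mem_eval_app _ _ _ _).1 hs
    rwa [show x = (fun i => i.elim) from funext fun i => i.elim] at hb
  exact Part.mem_unique (key A) (key B)

theorem star_dom : (M.fn Sym.star (fun i => i.elim)).Dom := by
  have h := M.holds _ Ax.star_def (fun x => x.elim) (M.sat_nil _)
  obtain ⟨y, hy, -⟩ := (M.sat_eq _ _ _).1 h
  obtain ⟨x, -, hb⟩ := (M.mem_eval_app _ _ _ _).1 hy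
  rw [show x = (fun i => i.elim) from funext fun i => i.elim] at hb
  exact hb.1

/-- The empty context. -/
def pt : Ob M 0 := (M.fn Sym.star (fun i => i.elim)).get star_dom

theorem sub_dom_iff (p : TmTy) {n k : ℕ} (B : Ob M n) (x : El M p k) (a : Fin k → Tm M n) :
    (sub p B x a).Dom ↔ IsHom B (ctxOf p x) a := by
  have e := eval_tSubst p (eval_varB B x a) (eval_varX B x a) (eval_varA B x a)
  have hh := sat_homFormula (eval_varB B x a) (eval_tCtx p (eval_varX B x a)) (eval_varA B x a)
  constructor
  · intro h
    refine hh.1 (M.holds _ (Ax.def_subst p n k) (args (X := M.carrier) B x a) ?_)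
    refine (M.sat_eq _ _ _).2 ?_
    rw [e]
    exact ⟨_, Part.get_mem h, Part.get_mem h⟩
  · intro h
    have := M.holds _ (Ax.subst_def p n k) (args (X := M.carrier) B x a) (hh.2 h)
    obtain ⟨y, hy, -⟩ := (M.sat_eq _ _ _).1 this
    rw [e] at hy
    exact hy.1

theorem ty_v (j i : ℕ) (A : Ob M (j + 1 + i)) : ty (v ⟨i, by omega⟩ A) ∈
    sub .ty (k := j) A (ftIter (n := j + 1) i A) (vs j (by omega) A) := by
  have h := M.holds _ (Ax.ty_v j i) (fun _ => A) (M.sat_nil _)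
  obtain ⟨y, hy, hy'⟩ := (M.sat_eq _ _ _).1 h
  rw [eval_tTy (eval_tV _ (eval_var₁ A)), Part.mem_some_iff] at hy
  rw [eval_tSubst .ty (eval_var₁ A) (eval_tFtIter i (eval_var₁ A)) (eval_tVs _ _ (eval_var₁ A)),
    hy] at hy'
  exact hy'

theorem ft_sub {n k : ℕ} {B : Ob M n} {A : Ob M (k + 1)} {a : Fin k → Tm M n} {y : Ob M (n + 1)}
    (hy : y ∈ sub .ty (k := k) B A a) : ft y = B := by
  have e := eval_tSubst .ty (eval_varB B A a) (eval_varX B A a) (eval_varA B A a)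
  have hh := sat_homFormula (eval_varB B A a) (eval_tFt (eval_varX B A a)) (eval_varA B A a)
  have h := M.holds _ (Ax.ft_subst n k) (args (X := M.carrier) B A a)
    (hh.2 ((sub_dom_iff .ty B A a).1 hy.1))
  obtain ⟨z, hz, hz'⟩ := (M.sat_eq _ _ _).1 h
  rw [eval_tFt (e.trans (Part.eq_some_iff.2 hy)), Part.mem_some_iff] at hz
  rw [eval_varB, Part.mem_some_iff] at hz'
  exact hz.symm.trans hz'

theorem ty_sub {n k : ℕ} {B : Ob M n} {x : Tm M k} {a : Fin k → Tm M n} {y : Tm M n}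
    (hy : y ∈ sub .tm (k := k) B x a) : ty y ∈ sub .ty (k := k) B (ty x) a := by
  have e := eval_tSubst .tm (eval_varB B x a) (eval_varX B x a) (eval_varA B x a)
  have e' := eval_tTy (e.trans (Part.eq_some_iff.2 hy))
  have h := M.holds _ (Ax.ty_subst n k) (args (X := M.carrier) B x a) (by
    refine (M.sat_eq _ _ _).2 ?_
    rw [e']
    exact ⟨_, Part.mem_some _, Part.mem_some _⟩)
  obtain ⟨z, hz, hz'⟩ := (M.sat_eq _ _ _).1 h
  rw [e', Part.mem_some_iff] at hz
  rw [eval_tSubst .ty (eval_varB B x a) (eval_tTy (eval_varX B x a)) (eval_varA B x a), hz] at hz'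
  exact hz'

theorem sub_vs (p : TmTy) {n : ℕ} (x : El M p n) :
    x ∈ sub p (ctxOf p x) x (vs n le_rfl (ctxOf p x)) := by
  have h := M.holds _ (Ax.subst_v p n) (fun _ => x) (M.sat_nil _)
  obtain ⟨y, hy, hy'⟩ := (M.sat_eq _ _ _).1 h
  rw [eval_tSubst p (eval_tCtx p (eval_var₁ x)) (eval_var₁ x)
    (eval_tVs _ _ (eval_tCtx p (eval_var₁ x)))] at hy
  rw [eval_var₁, Part.mem_some_iff] at hy'
  rwa [hy'] at hy

theorem v_sub {n k : ℕ} {B : Ob M n} {A : Ob M k} {a : Fin k → Tm M n} (h : IsHom B A a)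
    (i : Fin k) : a (Fin.rev i) ∈ sub .tm (k := k) B (v i A) a := by
  have hh := sat_homFormula (eval_varB B A a) (eval_varX B A a) (eval_varA B A a)
  have h := M.holds _ (Ax.v_subst n k i) (args (X := M.carrier) B A a) (hh.2 h)
  obtain ⟨y, hy, hy'⟩ := (M.sat_eq _ _ _).1 h
  rw [eval_tSubst .tm (eval_varB B A a) (eval_tV i (eval_varX B A a)) (eval_varA B A a)] at hy
  rw [eval_varA, Part.mem_some_iff] at hy'
  rwa [hy'] at hy

theorem sub_sub {p : TmTy} {n k m : ℕ} {C : Ob M n} {b : Fin k → Tm M n} {B : Ob M k}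
    {a : Fin m → Tm M k} {x : El M p m} (hb : IsHom C B b) {y : El M p k} (hy : y ∈ sub p B x a)
    {d : Fin m → Tm M n} (hd : ∀ i, d i ∈ sub .tm (k := k) C (a i) b) :
    sub p C x d = sub p C y b := by
  have eC : M.eval (V := compVars p n k m) (compArgs (X := M.carrier) C b B a x) cvarC =
      Part.some C := by
    unfold cvarC
    rw [Interpretation.eval]
    rfl
  have eb : ∀ i, M.eval (V := compVars p n k m) (compArgs (X := M.carrier) C b B a x) (cvarb i) =
      Part.some (b i) := by
    intro i
    unfold cvarb
    rw [Interpretation.eval]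
    rfl
  have eB : M.eval (V := compVars p n k m) (compArgs (X := M.carrier) C b B a x) cvarB =
      Part.some B := by
    unfold cvarB
    rw [Interpretation.eval]
    rfl
  have ea : ∀ i, M.eval (V := compVars p n k m) (compArgs (X := M.carrier) C b B a x) (cvara i) =
      Part.some (a i) := by
    intro i
    unfold cvara
    rw [Interpretation.eval]
    rfl
  have ex : M.eval (V := compVars p n k m) (compArgs (X := M.carrier) C b B a x) cvarx =
      Part.some x := by
    unfold cvarx
    rw [Interpretation.eval]
    rfl
  have h := M.holds _ (Ax.subst_subst p n k m) (compArgs (X := M.carrier) C b B a x) (by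
    refine (M.sat_append _ _ _).2 ⟨(sat_homFormula eC eB eb).2 hb, ?_⟩
    exact (sat_homFormula eB (eval_tCtx p ex) ea).2 ((sub_dom_iff p B x a).1 hy.1))
  obtain ⟨z, hz, hz'⟩ := (M.sat_eq _ _ _).1 h
  rw [eval_tSubst p eC ((eval_tSubst p eB ex ea).trans (Part.eq_some_iff.2 hy)) eb] at hz
  rw [eval_tSubst p eC ex (fun i => (eval_tSubst .tm eC (ea i) eb).trans
    (Part.eq_some_iff.2 (hd i)))] at hz'
  rw [Part.eq_some_iff.2 hz, Part.eq_some_iff.2 hz']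

/-! Morphisms. -/

theorem IsHom.ft_ty {n k : ℕ} {B : Ob M n} {A : Ob M k} {a : Fin k → Tm M n} (h : IsHom B A a)
    (i : Fin k) : ft (ty (a i)) = B := by
  induction k with
  | zero => exact i.elim0
  | succ k ih =>
    refine Fin.lastCases ?_ (fun i => ih h.1 i) i
    exact ft_sub h.2

/-- `x[f] = subst_{p,n,k}(B, x, a₁, …, aₖ)` for `f = (a₁, …, aₖ) : B → ctx_{p,k}(x)`. -/
def inst {p : TmTy} {n k : ℕ} {B : Ob M n} {x : El M p k} {a : Fin k → Tm M n}
    (h : IsHom B (ctxOf p x) a) : El M p n := (sub p B x a).get ((sub_dom_iff p B x a).2 h)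

theorem inst_mem {p : TmTy} {n k : ℕ} {B : Ob M n} {x : El M p k} {a : Fin k → Tm M n}
    (h : IsHom B (ctxOf p x) a) : inst h ∈ sub p B x a := Part.get_mem _

theorem IsHom.ctxOf_tm {n k m : ℕ} {A : Ob M n} {B : Ob M k} {C : Ob M m} {f : Fin k → Tm M n}
    {c : Fin m → Tm M k} (hf : IsHom A B f) (hc : IsHom B C c) (i : Fin m) :
    IsHom A (ctxOf .tm (c i)) f := by
  rw [show ctxOf .tm (c i) = B from hc.ft_ty i]
  exact hf

/-- The composite `(c₁[f], …, cₘ[f])` of `(c₁, …, cₘ) : B → C` and `f : A → B`. -/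
def comp {n k m : ℕ} {A : Ob M n} {B : Ob M k} {C : Ob M m} {f : Fin k → Tm M n}
    {c : Fin m → Tm M k} (hf : IsHom A B f) (hc : IsHom B C c) : Fin m → Tm M n :=
  fun i => inst (p := .tm) (hf.ctxOf_tm hc i)

theorem comp_mem {n k m : ℕ} {A : Ob M n} {B : Ob M k} {C : Ob M m} {f : Fin k → Tm M n}
    {c : Fin m → Tm M k} (hf : IsHom A B f) (hc : IsHom B C c) (i : Fin m) :
    comp hf hc i ∈ sub .tm (k := k) A (c i) f := inst_mem _

theorem isHom_of_mem {n k m : ℕ} {A : Ob M n} {B : Ob M k} {C : Ob M m} {f : Fin k → Tm M n}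
    {c : Fin m → Tm M k} (hf : IsHom A B f) (hc : IsHom B C c) {d : Fin m → Tm M n}
    (hd : ∀ i, d i ∈ sub .tm (k := k) A (c i) f) : IsHom A C d := by
  induction m with
  | zero => trivial
  | succ m ih =>
    refine ⟨ih hc.1 (fun i => hd _), ?_⟩
    rw [sub_sub (p := .ty) hf hc.2 (fun i => hd i.castSucc)]
    exact ty_sub (hd _)

theorem isHom_comp {n k m : ℕ} {A : Ob M n} {B : Ob M k} {C : Ob M m} {f : Fin k → Tm M n}
    {c : Fin m → Tm M k} (hf : IsHom A B f) (hc : IsHom B C c) : IsHom A C (comp hf hc) :=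
  isHom_of_mem hf hc (comp_mem hf hc)

theorem comp_eq {n k m : ℕ} {A : Ob M n} {B : Ob M k} {C : Ob M m} {f : Fin k → Tm M n}
    {c : Fin m → Tm M k} (hf : IsHom A B f) (hc : IsHom B C c) {d : Fin m → Tm M n}
    (hd : ∀ i, d i ∈ sub .tm (k := k) A (c i) f) : comp hf hc = d :=
  funext fun i => Part.mem_unique (comp_mem hf hc i) (hd i)

theorem sub_comp {p : TmTy} {n k m : ℕ} {A : Ob M n} {B : Ob M k} {C : Ob M m}
    {f : Fin k → Tm M n} {c : Fin m → Tm M k} (hf : IsHom A B f) (hc : IsHom B C c)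
    {x : El M p m} {y : El M p k} (hy : y ∈ sub p B x c) :
    sub p A x (comp hf hc) = sub p A y f := sub_sub hf hy (comp_mem hf hc)

theorem ft_heq {m m' : ℕ} (e : m = m') {A : Ob M (m + 1)} {A' : Ob M (m' + 1)} (h : HEq A A') :
    HEq (ft A) (ft A') := by
  subst e
  cases h
  rfl

theorem ft_ftIter (i : ℕ) {j : ℕ} (A : Ob M (j + 1 + i)) (A' : Ob M (j + (i + 1)))
    (h : HEq A A') : ft (ftIter (n := j + 1) i A) = ftIter (i + 1) A' := by
  induction i with
  | zero => cases h; rfl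
  | succ i ih => exact ih (ft A) (ft A') (ft_heq (by omega) h)

theorem isHom_vs_aux {j : ℕ} : ∀ {n : ℕ} (i : ℕ) (hn : n = j + i) (A : Ob M n) (A' : Ob M (j + i)),
    HEq A A' → IsHom A (ftIter i A') (vs j (by omega) A) := by
  induction j with
  | zero => intros; trivial
  | succ j ih =>
    intro n i hn A A' h
    subst hn
    obtain rfl := eq_of_heq h
    refine ⟨?_, ?_⟩
    · have e : j + 1 + i = j + (i + 1) := by omega
      have := ih (i + 1) e A (cast (congrArg (Ob M) e) A) (cast_heq _ _).symm
      rw [ft_ftIter i A _ (cast_heq _ _).symm]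
      exact this
    · have e : vs (j + 1) (by omega) A (Fin.last j) = v ⟨i, by omega⟩ A := by
        unfold vs
        congr 1
        ext
        simp
      rw [e]
      exact ty_v j i A

/-- Both the identity and the projections are given by tuples of variables. -/
theorem isHom_id {n : ℕ} (A : Ob M n) : IsHom A A (vs n le_rfl A) :=
  isHom_vs_aux 0 rfl A A HEq.rfl

theorem isHom_p {n : ℕ} (A : Ob M (n + 1)) : IsHom A (ft A) (vs n (Nat.le_succ n) A) :=
  isHom_vs_aux 1 rfl A A HEq.rfl

theorem vs_mem {n k j : ℕ} (hj : j ≤ k) {B : Ob M n} {A : Ob M k} {a : Fin k → Tm M n}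
    (h : IsHom B A a) (i : Fin j) : a (Fin.castLE hj i) ∈ sub .tm (k := k) B (vs j hj A i) a := by
  have := v_sub h (Fin.rev (Fin.castLE hj i))
  rwa [Fin.rev_rev] at this

theorem id_comp {n k : ℕ} {A : Ob M n} {B : Ob M k} {f : Fin k → Tm M n} (hf : IsHom A B f) :
    comp (isHom_id A) hf = f :=
  comp_eq _ _ fun i => by
    have := sub_vs .tm (f i)
    rwa [show ctxOf .tm (f i) = A from hf.ft_ty i] at this

theorem comp_id {n k : ℕ} {A : Ob M n} {B : Ob M k} {f : Fin k → Tm M n} (hf : IsHom A B f) :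
    comp hf (isHom_id B) = f :=
  comp_eq _ _ fun i => vs_mem le_rfl hf i

theorem comp_p {n k : ℕ} {A : Ob M n} {B : Ob M (k + 1)} {f : Fin (k + 1) → Tm M n}
    (hf : IsHom A B f) : comp hf (isHom_p B) = fun i => f i.castSucc :=
  comp_eq _ _ fun i => vs_mem (Nat.le_succ k) hf i

theorem comp_assoc {n k m l : ℕ} {A : Ob M n} {B : Ob M k} {C : Ob M m} {D : Ob M l}
    {f : Fin k → Tm M n} {g : Fin m → Tm M k} {h : Fin l → Tm M m} (hf : IsHom A B f)
    (hg : IsHom B C g) (hh : IsHom C D h) :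
    comp (isHom_comp hf hg) hh = comp hf (isHom_comp hg hh) :=
  comp_eq _ _ fun i => by
    rw [sub_comp (p := .tm) hf hg (comp_mem hg hh i)]
    exact comp_mem _ _ i

/-- The category of contexts of a model: morphisms `B → A` are the tuples `(a₁, …, aₖ)` such that
`Hom(B, A, a₁, …, aₖ)`. -/
instance homCategory (M : Model.{0, u} 𝕊) : Category.{u} (GradedObj (Ob M)) where
  Hom B A := {a : Fin A.level → Tm M B.level // IsHom B.obj A.obj a}
  id A := ⟨vs A.level le_rfl A.obj, isHom_id A.obj⟩
  comp f g := ⟨comp f.2 g.2, isHom_comp f.2 g.2⟩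
  id_comp f := Subtype.ext (id_comp f.2)
  comp_id f := Subtype.ext (comp_id f.2)
  assoc f g h := Subtype.ext (comp_assoc f.2 g.2 h.2)

theorem eqToHom_comp_val {n k : ℕ} {A A' : Ob M n} (e : A = A') {B : Ob M k}
    (f : GradedObj.of A' ⟶ GradedObj.of B) :
    (eqToHom (congrArg GradedObj.of e) ≫ f).1 = f.1 := by
  subst e
  simp

theorem eqToHom_val {n : ℕ} {A A' : Ob M n} (e : A = A') :
    (eqToHom (congrArg GradedObj.of e)).1 = vs n le_rfl A := by
  subst e
  rfl

/-- The projection `A → ft A`, i.e. the tuple `v_{n+1,n}(A), …, v_{n+1,1}(A)`. -/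
def proj {n : ℕ} {A : Ob M (n + 1)} {B : Ob M n} (h : ft A = B) :
    GradedObj.of A ⟶ GradedObj.of B :=
  ⟨vs n (Nat.le_succ n) A, h ▸ isHom_p A⟩

theorem comp_proj_val {n k : ℕ} {A : Ob M n} {B : Ob M (k + 1)} {D : Ob M k} (h : ft B = D)
    (f : GradedObj.of A ⟶ GradedObj.of B) : (f ≫ proj h).1 = fun i => f.1 i.castSucc := by
  subst h
  exact comp_p f.2

section Pullback

variable {n k : ℕ} {B : Ob M n} {D : Ob M k} {A : Ob M (k + 1)}

/-- `f^*(A) = A[f]`. -/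
def pb (h : ft A = D) (f : GradedObj.of B ⟶ GradedObj.of D) : Ob M (n + 1) :=
  inst (p := .ty) (B := B) (x := A) (a := f.1)
    (show IsHom B (ft A) f.1 from h.symm ▸ f.2)

theorem pb_mem (h : ft A = D) (f : GradedObj.of B ⟶ GradedObj.of D) :
    pb h f ∈ sub .ty (k := k) B A f.1 := inst_mem (p := .ty) _

theorem ft_pb (h : ft A = D) (f : GradedObj.of B ⟶ GradedObj.of D) : ft (pb h f) = B :=
  ft_sub (pb_mem h f)

/-- A tuple is a morphism into `A` iff its initial part is a morphism into `ft A` and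
the last component has the appropriate type. -/
theorem isHom_snoc {m : ℕ} {X : Ob M m} (h : ft A = D) (g : GradedObj.of X ⟶ GradedObj.of D)
    (a : Tm M m) (ha : ty a ∈ sub .ty (k := k) X A g.1) :
    IsHom X A (Fin.snoc (α := fun _ => Tm M m) g.1 a) := by
  refine ⟨?_, ?_⟩
  · simp only [Fin.snoc_castSucc]
    exact h.symm ▸ g.2
  · simp only [Fin.snoc_castSucc, Fin.snoc_last]
    exact ha

/-- The tuple with components `aᵢ[v_{n+1,n}(A[f]), …, v_{n+1,1}(A[f])]` for `1 ≤ i ≤ k`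
and last component `v_{n+1,0}(A[f])`. -/
def q (h : ft A = D) (f : GradedObj.of B ⟶ GradedObj.of D) :
    GradedObj.of (pb h f) ⟶ GradedObj.of A :=
  ⟨Fin.snoc (α := fun _ => Tm M (n + 1)) (proj (ft_pb h f) ≫ f).1 (v 0 (pb h f)), by
    refine isHom_snoc h _ _ ?_
    have e : sub .ty (k := k) (pb h f) A (proj (ft_pb h f) ≫ f).1 =
        sub .ty (k := n) (pb h f) (pb h f) (proj (ft_pb h f)).1 :=
      sub_comp (p := .ty) (proj (ft_pb h f)).2 f.2 (pb_mem h f)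
    rw [e]
    exact ty_v n 0 (pb h f)⟩

theorem hom_ext {m : ℕ} {X : Ob M m} (h : ft A = D) {f g : GradedObj.of X ⟶ GradedObj.of A}
    (h₁ : f ≫ proj h = g ≫ proj h) (h₂ : f.1 (Fin.last k) = g.1 (Fin.last k)) : f = g := by
  refine Subtype.ext (funext fun i => Fin.lastCases h₂ (fun i => ?_) i)
  have := congrArg Subtype.val h₁
  rw [comp_proj_val, comp_proj_val] at this
  exact congrFun this i

theorem comp_last {m : ℕ} {X : Ob M m} {Y : Ob M (n + 1)} (f : GradedObj.of X ⟶ GradedObj.of Y)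
    (g : GradedObj.of Y ⟶ GradedObj.of A) (hg : g.1 (Fin.last k) = v 0 Y) :
    (f ≫ g).1 (Fin.last k) = f.1 (Fin.last n) := by
  have h₁ : (f ≫ g).1 (Fin.last k) ∈ sub .tm (k := n + 1) X (g.1 (Fin.last k)) f.1 :=
    comp_mem f.2 g.2 _
  rw [hg] at h₁
  exact Part.mem_unique h₁ (v_sub f.2 0)

theorem q_last (h : ft A = D) (f : GradedObj.of B ⟶ GradedObj.of D) :
    (q h f).1 (Fin.last k) = v 0 (pb h f) :=
  Fin.snoc_last (α := fun _ => Tm M (n + 1)) _ _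

theorem q_proj (h : ft A = D) (f : GradedObj.of B ⟶ GradedObj.of D) :
    q h f ≫ proj h = proj (ft_pb h f) ≫ f := by
  refine Subtype.ext ?_
  rw [comp_proj_val]
  funext i
  exact Fin.snoc_castSucc (α := fun _ => Tm M (n + 1)) _ _ _

/-- The morphism `X → A[f]` with components `w` and the last component of `u`. -/
def lift {m : ℕ} {X : Ob M m} (h : ft A = D) (f : GradedObj.of B ⟶ GradedObj.of D)
    (u : GradedObj.of X ⟶ GradedObj.of A) (w : GradedObj.of X ⟶ GradedObj.of B)
    (e : u ≫ proj h = w ≫ f) : GradedObj.of X ⟶ GradedObj.of (pb h f) :=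
  ⟨Fin.snoc (α := fun _ => Tm M m) w.1 (u.1 (Fin.last k)), by
    refine isHom_snoc (ft_pb h f) w _ ?_
    have e' : sub .ty (k := k) X A (w ≫ f).1 = sub .ty (k := n) X (pb h f) w.1 :=
      sub_comp (p := .ty) w.2 f.2 (pb_mem h f)
    have hu : ty (u.1 (Fin.last k)) ∈ sub .ty (k := k) X A (fun i => u.1 i.castSucc) := u.2.2
    rwa [← comp_proj_val h u, e, e'] at hu⟩

theorem lift_proj {m : ℕ} {X : Ob M m} (h : ft A = D) (f : GradedObj.of B ⟶ GradedObj.of D)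
    (u : GradedObj.of X ⟶ GradedObj.of A) (w : GradedObj.of X ⟶ GradedObj.of B)
    (e : u ≫ proj h = w ≫ f) : lift h f u w e ≫ proj (ft_pb h f) = w := by
  refine Subtype.ext ((comp_proj_val _ _).trans ?_)
  funext i
  exact Fin.snoc_castSucc (α := fun _ => Tm M m) _ _ _

theorem lift_q {m : ℕ} {X : Ob M m} (h : ft A = D) (f : GradedObj.of B ⟶ GradedObj.of D)
    (u : GradedObj.of X ⟶ GradedObj.of A) (w : GradedObj.of X ⟶ GradedObj.of B)
    (e : u ≫ proj h = w ≫ f) : lift h f u w e ≫ q h f = u := by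
  refine hom_ext h ?_ ?_
  · rw [Category.assoc, q_proj, ← Category.assoc, lift_proj, e]
  · exact (comp_last _ _ (q_last h f)).trans (Fin.snoc_last (α := fun _ => Tm M m) _ _)

theorem pb_hom_ext {m : ℕ} {X : Ob M m} (h : ft A = D) (f : GradedObj.of B ⟶ GradedObj.of D)
    {l l' : GradedObj.of X ⟶ GradedObj.of (pb h f)} (h₁ : l ≫ q h f = l' ≫ q h f)
    (h₂ : l ≫ proj (ft_pb h f) = l' ≫ proj (ft_pb h f)) : l = l' := by
  refine hom_ext (ft_pb h f) h₂ ?_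
  rw [← comp_last l _ (q_last h f), ← comp_last l' _ (q_last h f), h₁]

theorem isPullback (h : ft A = D) (f : GradedObj.of B ⟶ GradedObj.of D) :
    IsPullback (q h f) (proj (ft_pb h f)) (proj h) f :=
  ⟨⟨q_proj h f⟩, ⟨Limits.PullbackCone.IsLimit.mk _
    (fun s => lift (X := s.pt.obj) h f s.fst s.snd s.condition)
    (fun s => lift_q (X := s.pt.obj) h f s.fst s.snd s.condition)
    (fun s => lift_proj (X := s.pt.obj) h f s.fst s.snd s.condition)
    (fun s _ h₁ h₂ => pb_hom_ext (X := s.pt.obj) h f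
      (h₁.trans (lift_q (X := s.pt.obj) h f s.fst s.snd s.condition).symm)
      (h₂.trans (lift_proj (X := s.pt.obj) h f s.fst s.snd s.condition).symm))⟩⟩

theorem pb_id (h : ft A = D) : pb h (𝟙 (GradedObj.of D)) = A := by
  subst h
  exact Part.mem_unique (pb_mem rfl _) (sub_vs .ty A)

theorem pb_comp {m : ℕ} {C : Ob M m} (h : ft A = D) (g : GradedObj.of C ⟶ GradedObj.of B)
    (f : GradedObj.of B ⟶ GradedObj.of D) : pb h (g ≫ f) = pb (ft_pb h f) g := by
  have h₁ := pb_mem h (g ≫ f)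
  have e : sub .ty (k := k) C A (g ≫ f).1 = sub .ty (k := n) C (pb h f) g.1 :=
    sub_comp (p := .ty) g.2 f.2 (pb_mem h f)
  rw [e] at h₁
  exact Part.mem_unique h₁ (pb_mem _ _)

theorem eqToHom_proj {n : ℕ} {A A' : Ob M (n + 1)} {B : Ob M n} (e : A = A') (h : ft A' = B) :
    eqToHom (congrArg GradedObj.of e) ≫ proj h = proj (e ▸ h) := by
  subst e
  simp

theorem eqToHom_last {n : ℕ} {A A' : Ob M (n + 1)} (e : A = A') :
    (eqToHom (congrArg GradedObj.of e)).1 (Fin.last n) = v 0 A := by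
  rw [eqToHom_val e]
  unfold vs
  congr 1
  ext
  simp

theorem q_id (h : ft A = D) :
    q h (𝟙 (GradedObj.of D)) = eqToHom (congrArg GradedObj.of (pb_id h)) := by
  refine hom_ext h ?_ ?_
  · rw [q_proj, Category.comp_id, eqToHom_proj (pb_id h)]
  · rw [q_last, eqToHom_last (pb_id h)]

theorem q_comp {m : ℕ} {C : Ob M m} (h : ft A = D) (g : GradedObj.of C ⟶ GradedObj.of B)
    (f : GradedObj.of B ⟶ GradedObj.of D) :
    q h (g ≫ f) = eqToHom (congrArg GradedObj.of (pb_comp h g f)) ≫ q (ft_pb h f) g ≫ q h f := by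
  refine hom_ext h ?_ ?_
  · rw [q_proj, Category.assoc, Category.assoc, q_proj, ← Category.assoc (q _ _), q_proj,
      Category.assoc, ← Category.assoc (eqToHom _), eqToHom_proj (pb_comp h g f)]
  · rw [q_last, eqToHom_comp_val (pb_comp h g f), comp_last _ _ (q_last h f), q_last, pb_comp]

end Pullback

/-- The contextual category `F(M)` of a model `M` of the theory of substitutions. -/
def FObj (M : Model.{0, u} 𝕊) : CCat.{u} where
  Ob := Ob M
  cat := homCategory M
  pt := pt
  eq_pt A := eq_pt A pt
  terminal _ := ⟨⟨⟨⟨fun i => i.elim0, trivial⟩⟩, fun _ => Subtype.ext (funext fun i => i.elim0)⟩⟩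
  ft := ft
  p := proj
  pb := pb
  ft_pb := ft_pb
  q := q
  isPullback := isPullback
  pb_id := pb_id
  q_id := q_id
  pb_comp := pb_comp
  q_comp := q_comp

/-- The components `(a₁, …, aₖ)` of a morphism of `F(M)`. -/
def components {M : Model.{0, u} 𝕊} {n k : ℕ} {A : (FObj M).Ob n} {B : (FObj M).Ob k}
    (f : GradedObj.of A ⟶ GradedObj.of B) : Fin k → Tm M n := f.1

end SubstTheory

/-! ## The functor on morphisms -/

namespace SubstTheory

open PartialHorn

section Map

variable {M N : Model.{0, u} 𝕊} (α : M ⟶ N)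

/-! A morphism of models commutes strictly with the total operations `ft`, `ty` and `v` and
preserves defined substitutions. Composition, pullbacks and the morphisms `q` of `F(M)` are built
from these, so `F(α)` preserves them. The equivalence is then proved as full, faithful and
essentially surjective.

Full faithfulness rests on the fact that a term `a` is the same as a section of the projection of
`ty a`, namely the tuple of all variables followed by `a` (`sect`). A morphism `G : F(M) → F(N)`
therefore determines an action on terms: take the last component of `G (sect a)` (`tmOf`). The key
point is `homOf_val`: `G` acts on every tuple componentwise through this action. Indeed a morphism
into an extended context factors as a section followed by some `q`, and `G` preserves `q`
(`homOf_last`); the earlier components are reached by projections. Compatibility with substitution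
then follows from preservation of composition and pullbacks (`tmOf_sub`, `objOf_sub`).

For essential surjectivity, a contextual category `C` gives a model whose contexts are the objects
and whose terms are sections of canonical projections. The universal property of the canonical
pullback turns a morphism into `A` over `ft A` into such a section (`sec`); iterating down the tower
of projections turns a morphism into a tuple (`comps`), injectively. By `exists_comps_eq_succ_iff`
the tuples so obtained are exactly those satisfying the formula `Hom`, and substitution is
reindexing along the unique corresponding morphism. The axioms come down to functoriality of
reindexing (`inst_id`, `inst_comp`) and to `comps_comp_mem`. Finally `comps` identifies the
morphisms of `C` with those of `F` of this model, compatibly with all the structure. -/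

theorem app_ft {n : ℕ} (A : Ob M (n + 1)) :
    α.app (.ctx, n) (ft A) = ft (α.app (.ctx, n + 1) A) :=
  Part.mem_unique (α.app_fn (Sym.ft n) (fun _ => A) _ (Part.get_mem (ft_dom A))) (Part.get_mem _)

theorem app_ty {n : ℕ} (a : Tm M n) :
    α.app (.ctx, n + 1) (ty a) = ty (α.app (.tm, n) a) :=
  Part.mem_unique (α.app_fn (Sym.ty n) (fun _ => a) _ (Part.get_mem (ty_dom a))) (Part.get_mem _)

theorem app_v {n : ℕ} (i : Fin n) (A : Ob M n) :
    α.app (.tm, n) (v i A) = v i (α.app (.ctx, n) A) :=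
  Part.mem_unique (α.app_fn (Sym.v n i) (fun _ => A) _ (Part.get_mem (v_dom i A)))
    (Part.get_mem _)

theorem app_sub {p : TmTy} {n k : ℕ} {B : Ob M n} {x : El M p k} {a : Fin k → Tm M n}
    {y : El M p n} (hy : y ∈ sub p B x a) :
    α.app (p.sort n) y ∈
      sub p (α.app (.ctx, n) B) (α.app (p.sort k) x) (fun i => α.app (.tm, n) (a i)) := by
  have h := α.app_fn (Sym.subst p n k) (args (X := M.carrier) B x a) y hy
  have e : (fun i => α.app _ (args (X := M.carrier) B x a i)) =
      args (X := N.carrier) (α.app (.ctx, n) B) (α.app (p.sort k) x)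
        (fun i => α.app (.tm, n) (a i)) := by
    funext i
    cases i <;> rfl
  unfold sub
  rw [← e]
  exact h

theorem IsHom.app {n k : ℕ} {B : Ob M n} {A : Ob M k} {a : Fin k → Tm M n} (h : IsHom B A a) :
    IsHom (α.app (.ctx, n) B) (α.app (.ctx, k) A) (fun i => α.app (.tm, n) (a i)) := by
  induction k with
  | zero => trivial
  | succ k ih =>
    refine ⟨?_, ?_⟩
    · rw [← app_ft]
      exact ih h.1
    · rw [← app_ty]
      exact app_sub (p := .ty) α h.2

/-- The morphism part of `F(α)`. -/
def mapHom {n k : ℕ} {A : Ob M n} {B : Ob M k} (f : GradedObj.of A ⟶ GradedObj.of B) :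
    GradedObj.of (Ob := Ob N) (α.app (.ctx, n) A) ⟶
      GradedObj.of (Ob := Ob N) (α.app (.ctx, k) B) :=
  ⟨fun i => α.app (.tm, n) (f.1 i), IsHom.app α f.2⟩

theorem mapHom_comp {n k m : ℕ} {A : Ob M n} {B : Ob M k} {C : Ob M m}
    (f : GradedObj.of A ⟶ GradedObj.of B) (g : GradedObj.of B ⟶ GradedObj.of C) :
    mapHom α (f ≫ g) = mapHom α f ≫ mapHom α g :=
  Subtype.ext (comp_eq (mapHom α f).2 (mapHom α g).2
    fun i => app_sub (p := .tm) α (comp_mem f.2 g.2 i)).symm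

theorem app_pb {n k : ℕ} {B : Ob M n} {D : Ob M k} {A : Ob M (k + 1)} (h : ft A = D)
    (f : GradedObj.of B ⟶ GradedObj.of D) (h' : ft (α.app (.ctx, k + 1) A) = α.app (.ctx, k) D) :
    α.app (.ctx, n + 1) (pb h f) = pb h' (mapHom α f) :=
  Part.mem_unique (app_sub (p := .ty) α (pb_mem h f)) (pb_mem h' (mapHom α f))

/-- A morphism into `A` is determined by its projection and its last component. The projections
agree by the commuting square of `q`; both last components are the variable `v 0`, which `α`
preserves. -/
theorem mapHom_q {n k : ℕ} {B : Ob M n} {D : Ob M k} {A : Ob M (k + 1)} (h : ft A = D)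
    (f : GradedObj.of B ⟶ GradedObj.of D) (h' : ft (α.app (.ctx, k + 1) A) = α.app (.ctx, k) D) :
    mapHom α (q h f) =
      eqToHom (congrArg GradedObj.of (app_pb α h f h')) ≫ q h' (mapHom α f) := by
  have hp : mapHom α (proj (ft_pb h f)) = proj (by rw [← app_ft, ft_pb]) :=
    Subtype.ext (funext fun _ => app_v α _ _)
  have hp' : mapHom α (proj h) = proj h' := Subtype.ext (funext fun _ => app_v α _ _)
  have e := app_pb α h f h'
  refine hom_ext h' ?_ ?_
  · rw [Category.assoc, q_proj, ← Category.assoc, eqToHom_proj e, ← hp', ← mapHom_comp, q_proj,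
      mapHom_comp, hp]
  · rw [eqToHom_comp_val e, q_last, ← e]
    exact (congrArg (α.app (.tm, n + 1)) (q_last h f)).trans (app_v α 0 _)

/-- The morphism `F(α) : F(M) → F(N)` of contextual categories. -/
def FMap : FObj M ⟶ FObj N where
  obj {n} A := α.app (.ctx, n) A
  map f := mapHom α f
  map_id A := Subtype.ext (funext fun _ => app_v α _ A)
  map_comp f g := mapHom_comp α f g
  obj_ft {n A _} h := (app_ft α (n := n) A).symm.trans (congrArg (α.app (.ctx, n)) h)
  map_p {_ A _} _ := Subtype.ext (funext fun _ => app_v α _ A)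
  obj_pb {_ k _ _ A} h f := app_pb α h f
    ((app_ft α (n := k) A).symm.trans (congrArg (α.app (.ctx, k)) h))
  map_q {_ k _ _ A} h f := mapHom_q α h f
    ((app_ft α (n := k) A).symm.trans (congrArg (α.app (.ctx, k)) h))

end Map

/-! ## The functor is fully faithful -/

/-! ### Terms as sections of projections -/

section Section

variable {M : Model.{0, u} 𝕊}

/-- The section of the projection `ty a → ft (ty a)` corresponding to a term `a`. -/
def sect {n : ℕ} (a : Tm M n) : GradedObj.of (ft (ty a)) ⟶ GradedObj.of (ty a) :=
  ⟨Fin.snoc (α := fun _ => Tm M n) (vs n le_rfl (ft (ty a))) a,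
    isHom_snoc rfl (𝟙 (GradedObj.of (ft (ty a)))) a (sub_vs .ty (ty a))⟩

theorem sect_last {n : ℕ} (a : Tm M n) : (sect a).1 (Fin.last n) = a :=
  Fin.snoc_last (α := fun _ => Tm M n) _ _

/-- The initial components of a section are the variables, and substituting the variables into `A`
gives back `A` (`sub_vs`). -/
theorem ty_last {n : ℕ} {B : Ob M n} {A : Ob M (n + 1)} (h : ft A = B)
    (s : GradedObj.of B ⟶ GradedObj.of A) (hs : s ≫ proj h = 𝟙 _) :
    ty (s.1 (Fin.last n)) = A := by
  have h₁ : ty (s.1 (Fin.last n)) ∈ sub .ty (k := n) B A (fun i => s.1 i.castSucc) := s.2.2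
  rw [← comp_proj_val h s, hs] at h₁
  subst h
  exact Part.mem_unique h₁ (sub_vs .ty A)

theorem sect_proj {n : ℕ} (a : Tm M n) : sect a ≫ proj rfl = 𝟙 _ := by
  refine Subtype.ext ((comp_proj_val _ _).trans ?_)
  funext i
  exact Fin.snoc_castSucc (α := fun _ => Tm M n) _ _ _

theorem ty_last_eq_pb {n k : ℕ} {B : Ob M n} {A : Ob M (k + 1)} {D : Ob M k} (h : ft A = D)
    (f : GradedObj.of B ⟶ GradedObj.of A) : ty (f.1 (Fin.last k)) = pb h (f ≫ proj h) := by
  have h₁ : ty (f.1 (Fin.last k)) ∈ sub .ty (k := k) B A (fun i => f.1 i.castSucc) := f.2.2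
  rw [← comp_proj_val h f] at h₁
  exact Part.mem_unique h₁ (pb_mem h _)

/-- The section induced by `f` has the same underlying tuple shape as `sect` of the last component
of `f`, which lets `homOf_section_last` apply to it. -/
theorem lift_id_val {n k : ℕ} {B : Ob M n} {A : Ob M (k + 1)} {D : Ob M k} (h : ft A = D)
    (f : GradedObj.of B ⟶ GradedObj.of A) (e : f ≫ proj h = 𝟙 _ ≫ f ≫ proj h) :
    (lift h (f ≫ proj h) f (𝟙 _) e).1 =
      Fin.snoc (α := fun _ => Tm M n) (vs n le_rfl B) (f.1 (Fin.last k)) := rfl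

end Section

/-! ### Fullness: recovering a morphism of models -/

section Full

variable {M N : Model.{0, u} 𝕊} (G : FObj M ⟶ FObj N)

/-- The object part of a morphism `F(M) → F(N)`. -/
abbrev objOf {n : ℕ} (A : Ob M n) : Ob N n := G.obj A

/-- The morphism part of a morphism `F(M) → F(N)`. -/
def homOf {n k : ℕ} {A : Ob M n} {B : Ob M k} (f : GradedObj.of A ⟶ GradedObj.of B) :
    GradedObj.of (objOf G A) ⟶ GradedObj.of (objOf G B) := G.map f

theorem homOf_comp {n k m : ℕ} {A : Ob M n} {B : Ob M k} {C : Ob M m}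
    (f : GradedObj.of A ⟶ GradedObj.of B) (g : GradedObj.of B ⟶ GradedObj.of C) :
    homOf G (f ≫ g) = homOf G f ≫ homOf G g := G.map_comp f g

theorem homOf_id {n : ℕ} (A : Ob M n) : homOf G (𝟙 (GradedObj.of A)) = 𝟙 _ := G.map_id A

theorem ft_objOf {n : ℕ} {A : Ob M (n + 1)} {B : Ob M n} (h : ft A = B) :
    ft (objOf G A) = objOf G B := G.obj_ft h

theorem homOf_proj {n : ℕ} {A : Ob M (n + 1)} {B : Ob M n} (h : ft A = B) :
    homOf G (proj h) = proj (ft_objOf G h) := G.map_p h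

theorem objOf_pb {n k : ℕ} {B : Ob M n} {D : Ob M k} {A : Ob M (k + 1)} (h : ft A = D)
    (f : GradedObj.of B ⟶ GradedObj.of D) : objOf G (pb h f) = pb (ft_objOf G h) (homOf G f) :=
  G.obj_pb h f

theorem homOf_q {n k : ℕ} {B : Ob M n} {D : Ob M k} {A : Ob M (k + 1)} (h : ft A = D)
    (f : GradedObj.of B ⟶ GradedObj.of D) : homOf G (q h f) =
      eqToHom (congrArg GradedObj.of (objOf_pb G h f)) ≫ q (ft_objOf G h) (homOf G f) :=
  G.map_q h f

/-- The action on terms of a morphism `F(M) → F(N)`. -/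
def tmOf {n : ℕ} (a : Tm M n) : Tm N n := (homOf G (sect a)).1 (Fin.last n)

/-- The endpoints are kept as variables with equations because the sections met in `homOf_last` live
over a pullback that is only propositionally equal to `ty a`. -/
theorem homOf_section_last {n : ℕ} (a : Tm M n) {X : Ob M n} {Y : Ob M (n + 1)}
    (hY : ty a = Y) (hX : ft Y = X) (s : GradedObj.of X ⟶ GradedObj.of Y)
    (hs : s.1 = Fin.snoc (α := fun _ => Tm M n) (vs n le_rfl X) a) :
    (homOf G s).1 (Fin.last n) = tmOf G a := by
  subst hY hX
  rw [show s = sect a from Subtype.ext hs, tmOf]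

/-- Factor `f` as the section it induces followed by `q`. Since `G` preserves `q`, and composing
with `q` does not change the last component, only the image of the section matters, and that is
`tmOf` by definition. -/
theorem homOf_last {n k : ℕ} {B : Ob M n} {A : Ob M (k + 1)}
    (f : GradedObj.of B ⟶ GradedObj.of A) :
    (homOf G f).1 (Fin.last k) = tmOf G (f.1 (Fin.last k)) := by
  have e : f ≫ proj rfl = 𝟙 _ ≫ f ≫ proj rfl := (Category.id_comp _).symm
  have h₁ : homOf G f =
      (homOf G (lift rfl (f ≫ proj rfl) f (𝟙 _) e) ≫
        eqToHom (congrArg GradedObj.of (objOf_pb G rfl (f ≫ proj rfl)))) ≫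
        q (ft_objOf G rfl) (homOf G (f ≫ proj rfl)) := by
    rw [Category.assoc, ← homOf_q, ← homOf_comp, lift_q]
  rw [h₁, comp_last _ _ (q_last _ _)]
  -- The transport also has `v 0` as its last component, so it can be dropped like `q`.
  refine (comp_last _ _ (eqToHom_last (objOf_pb G rfl (f ≫ proj rfl)))).trans ?_
  exact homOf_section_last G _ (ty_last_eq_pb rfl f) (ft_pb _ _) _ (lift_id_val rfl f e)

/-- Projecting away the last component reduces the earlier ones to a shorter tuple, and `G`
preserves projections. -/
theorem homOf_val {n k : ℕ} {B : Ob M n} {A : Ob M k} (f : GradedObj.of B ⟶ GradedObj.of A)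
    (i : Fin k) : (homOf G f).1 i = tmOf G (f.1 i) := by
  induction k with
  | zero => exact i.elim0
  | succ k ih =>
    refine Fin.lastCases (homOf_last G f) (fun i => ?_) i
    have h := ih (f ≫ proj rfl) i
    rwa [homOf_comp, homOf_proj, comp_proj_val, comp_proj_val] at h

/-- `G` sends `sect a` to a section of the projection of `G (ty a)`, and `ty_last` reads off the
type of its last component. -/
theorem ty_tmOf {n : ℕ} (a : Tm M n) : objOf G (ty a) = ty (tmOf G a) := by
  have h : ft (ty a) = ft (ty a) := rfl
  refine (ty_last (ft_objOf G h) (homOf G (sect a)) ?_).symm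
  rw [← homOf_proj G h, ← homOf_comp, sect_proj, homOf_id]

/-- Variables are the components of identities, which `G` preserves. -/
theorem tmOf_v {n : ℕ} (i : Fin n) (A : Ob M n) : tmOf G (v i A) = v i (objOf G A) := by
  have h := homOf_val G (𝟙 (GradedObj.of A)) (Fin.rev i)
  rw [homOf_id] at h
  have e : ∀ {K : Model.{0, u} 𝕊} (B : Ob K n), (𝟙 (GradedObj.of B) : _ ⟶ _).1 (Fin.rev i) =
      v i B := fun B => congrArg (fun j => v j B) (Fin.rev_rev i)
  rw [e, e] at h
  exact h.symm

/-- Substituting a tuple `f` into `x` is taking the last component of `f ≫ sect x`, so preservation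
of composition suffices. -/
theorem tmOf_sub {n k : ℕ} {B : Ob M n} {x : Tm M k} {a : Fin k → Tm M n} {y : Tm M n}
    (hy : y ∈ sub .tm (k := k) B x a) :
    tmOf G y ∈ sub .tm (k := k) (objOf G B) (tmOf G x) (fun i => tmOf G (a i)) := by
  have ha : IsHom B (ft (ty x)) a := (sub_dom_iff .tm B x a).1 hy.1
  let f : GradedObj.of B ⟶ GradedObj.of (ft (ty x)) := ⟨a, ha⟩
  have hf : (homOf G f).1 = fun i => tmOf G (a i) := funext (homOf_val G f)
  have h₁ : (f ≫ sect x).1 (Fin.last k) = y := by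
    refine Part.mem_unique (comp_mem f.2 (sect x).2 (Fin.last k)) ?_
    rw [sect_last]
    exact hy
  rw [← h₁, ← homOf_last, homOf_comp, ← hf]
  exact comp_mem (homOf G f).2 (homOf G (sect x)).2 (Fin.last k)

theorem objOf_sub {n k : ℕ} {B : Ob M n} {x : Ob M (k + 1)} {a : Fin k → Tm M n}
    {y : Ob M (n + 1)} (hy : y ∈ sub .ty (k := k) B x a) :
    objOf G y ∈ sub .ty (k := k) (objOf G B) (objOf G x) (fun i => tmOf G (a i)) := by
  have ha : IsHom B (ft x) a := (sub_dom_iff .ty B x a).1 hy.1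
  let f : GradedObj.of B ⟶ GradedObj.of (ft x) := ⟨a, ha⟩
  have hf : (homOf G f).1 = fun i => tmOf G (a i) := funext (homOf_val G f)
  rw [Part.mem_unique hy (pb_mem rfl f), objOf_pb, ← hf]
  exact pb_mem _ _

/-- The action of a morphism `F(M) → F(N)` on the elements of all sorts. -/
def appOf : ∀ s : Kind × ℕ, M.carrier s → N.carrier s
  | (.ctx, _) => objOf G
  | (.tm, _) => tmOf G

/-- The morphism of models with `F(α) = G`. -/
def preimage : M ⟶ N where
  app := appOf G
  app_fn
    | .star, x, y, _ => by
      rw [eq_pt (appOf G _ y) pt, show (fun i => appOf G _ (x i)) = (fun i => i.elim) from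
        funext fun i => i.elim]
      exact Part.get_mem star_dom
    | .ft n, x, y, h => by
      rw [Part.mem_unique h (Part.get_mem (ft_dom (x ())))]
      have e : objOf G (ft (x ())) = ft (objOf G (x ())) := (ft_objOf G rfl).symm
      exact Part.eq_get_iff_mem _ |>.1 e
    | .ty n, x, y, h => by
      rw [Part.mem_unique h (Part.get_mem (ty_dom (x ())))]
      exact Part.eq_get_iff_mem _ |>.1 (ty_tmOf G (x ()))
    | .v n i, x, y, h => by
      rw [Part.mem_unique h (Part.get_mem (v_dom i (x ())))]
      exact Part.eq_get_iff_mem _ |>.1 (tmOf_v G i (x ()))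
    | .subst p n k, x, y, h => by
      have e : x = args (X := M.carrier) (x .base) (x .body) (fun i => x (.sub i)) := by
        funext i
        cases i <;> rfl
      have e' : (fun i => appOf G _ (x i)) = args (X := N.carrier) (appOf G (.ctx, n) (x .base))
          (appOf G (p.sort k) (x .body)) (fun i => appOf G (.tm, n) (x (.sub i))) := by
        funext i
        cases i <;> rfl
      rw [e] at h
      rw [e']
      cases p
      · exact tmOf_sub G h
      · exact objOf_sub G h
  app_rel R := R.elim

theorem FMap_preimage : FMap (preimage G) = G := by
  -- The object parts agree by definition, so the heterogeneous equality of the morphism parts is an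
  -- ordinary one.
  refine CCat.Hom.ext rfl ?_
  refine heq_of_eq ?_
  funext n k A B f
  exact Subtype.ext (funext fun i => (homOf_val G f i).symm)

end Full

/-! ### Faithfulness -/

theorem FMap_injective {M N : Model.{0, u} 𝕊} : Function.Injective (FMap (M := M) (N := N)) := by
  intro α β h
  have hobj : ∀ (n : ℕ) (A : Ob M n), α.app (.ctx, n) A = β.app (.ctx, n) A := fun n A =>
    congrArg (fun G : FObj M ⟶ FObj N => objOf G A) h
  have htm : ∀ (n : ℕ) (a : Tm M n), α.app (.tm, n) a = β.app (.tm, n) a := by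
    intro n a
    have h₁ := congrArg (fun G : FObj M ⟶ FObj N => tmOf G a) h
    -- The action on terms is recovered from `F(γ)`, because the last component of `sect a` is `a`.
    have e : ∀ γ : M ⟶ N, tmOf (FMap γ) a = γ.app (.tm, n) a := fun γ =>
      congrArg (γ.app (.tm, n)) (sect_last a)
    exact (e α).symm.trans (h₁.trans (e β))
  refine Model.Hom.ext (funext fun s => funext fun x => ?_)
  obtain ⟨s, n⟩ := s
  cases s
  · exact hobj n x
  · exact htm n x

/-- The functor `F` from models of the theory of substitutions to contextual categories. -/
def functorF : Model.{0, u} 𝕊 ⥤ CCat.{u} where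
  obj := FObj
  map := FMap
  map_id _ := rfl
  map_comp _ _ := rfl

end SubstTheory

/-! ## The model of a contextual category -/

namespace PartialHorn.Interpretation

variable {Sg : Signature.{w}} (M : Interpretation.{w, u} Sg) {V : Vars Sg.Srt}

theorem eval_var (ρ : ∀ x, M.carrier (V.sort x)) (x : V.Var) :
    M.eval ρ (.var x) = Part.some (ρ x) := by
  rw [eval]

theorem eval_app (ρ : ∀ x, M.carrier (V.sort x)) (σ : Sg.Fn)
    (t : ∀ i, Term Sg V (Sg.fnDom σ i)) (y : ∀ i, M.carrier (Sg.fnDom σ i))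
    (h : ∀ i, M.eval ρ (t i) = Part.some (y i)) : M.eval ρ (.app σ t) = M.fn σ y := by
  ext b
  rw [mem_eval_app]
  simp only [h, Part.mem_some_iff]
  constructor
  · rintro ⟨x, hx, hb⟩
    rwa [← show x = y from funext hx]
  · exact fun hb => ⟨y, fun _ => rfl, hb⟩

end PartialHorn.Interpretation

namespace CCat

open GradedObj PartialHorn SubstTheory

/-- Sections of the canonical projections of a contextual category. -/
structure Sec (C : CCat.{u}) (n : ℕ) : Type u where
  base : C.Ob n
  ty : C.Ob (n + 1)
  ft_ty : C.ft ty = base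
  hom : of base ⟶ of ty
  hom_p : hom ≫ C.p ft_ty = 𝟙 _

/-! ### Sections induced by morphisms -/

variable {C : CCat.{u}}

/-- The morphism to the pullback of `A` along `w` induced by a morphism `u` to `A` over `w`,
a section of the canonical projection. -/
noncomputable def graph {n k : ℕ} {B : C.Ob n} {D : C.Ob k} {A : C.Ob (k + 1)} (h : C.ft A = D)
    (w : of B ⟶ of D) (u : of B ⟶ of A) (e : u ≫ C.p h = w) : of B ⟶ of (C.pb h w) :=
  (C.isPullback h w).lift u (𝟙 _) (by rw [e, Category.id_comp])

section

variable {n k : ℕ} {B : C.Ob n} {D : C.Ob k} {A : C.Ob (k + 1)} (h : C.ft A = D)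
  (w : of B ⟶ of D) (u : of B ⟶ of A) (e : u ≫ C.p h = w)

theorem graph_p : graph h w u e ≫ C.p (C.ft_pb h w) = 𝟙 _ :=
  (C.isPullback h w).lift_snd _ _ _

theorem graph_q : graph h w u e ≫ C.q h w = u :=
  (C.isPullback h w).lift_fst _ _ _

/-- The section induced by a morphism `u` to `A`. -/
noncomputable def sec : C.Sec n :=
  ⟨B, C.pb h (u ≫ C.p h), C.ft_pb h _, graph h _ u rfl, graph_p h _ u rfl⟩

theorem mk_graph_eq_sec :
    Sec.mk B (C.pb h w) (C.ft_pb h w) (graph h w u e) (graph_p h w u e) = sec h u := by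
  subst e
  rfl

/-- Recognition criterion: uniqueness in the pullback forces `s` to be the induced section.
Equalities between types are absorbed here, so that later identities of sections reduce to
composites with `q`. -/
theorem mk_eq_sec (e : u ≫ C.p h = w) {A' : C.Ob (n + 1)}
    (h' : C.ft A' = B) (s : of B ⟶ of A') (hs : s ≫ C.p h' = 𝟙 _) (e' : A' = C.pb h w)
    (hu : s ≫ eqToHom (congrArg of e') ≫ C.q h w = u) : Sec.mk B A' h' s hs = sec h u := by
  rw [← mk_graph_eq_sec h w u e]
  subst e'
  have : s = graph h w u e := by
    refine (C.isPullback h w).hom_ext ?_ ?_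
    · rw [graph_q, ← hu, eqToHom_refl, Category.id_comp]
    · rw [graph_p, ← hs]
  subst this
  rfl

end

theorem sec_of_section {n : ℕ} {B : C.Ob n} {A : C.Ob (n + 1)} (h : C.ft A = B)
    (s : of B ⟶ of A) (hs : s ≫ C.p h = 𝟙 _) : sec h s = ⟨B, A, h, s, hs⟩ := by
  refine (mk_eq_sec h (𝟙 _) s hs h s hs (C.pb_id h).symm ?_).symm
  rw [C.q_id, eqToHom_trans, eqToHom_refl, Category.comp_id]

/-- Pulling back in two stages is pulling back along the composite (`pb_comp`, `q_comp`), so a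
morphism into a pullback and its composite with `q` induce the same section. -/
theorem sec_comp_q {m n k : ℕ} {X : C.Ob m} {B : C.Ob n} {D : C.Ob k} {A : C.Ob (k + 1)}
    (h : C.ft A = D) (f : of B ⟶ of D) (g : of X ⟶ of (C.pb h f)) :
    sec h (g ≫ C.q h f) = sec (C.ft_pb h f) g := by
  refine (mk_eq_sec h ((g ≫ C.p (C.ft_pb h f)) ≫ f) _ ?_ _ _
    (graph_p (C.ft_pb h f) _ g rfl) (C.pb_comp h _ f).symm ?_).symm
  · rw [Category.assoc, Category.assoc, (C.isPullback h f).w]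
  · rw [C.q_comp, eqToHom_trans_assoc, eqToHom_refl, Category.id_comp, ← Category.assoc,
      graph_q]

theorem sec_comp {m n k : ℕ} {X : C.Ob m} {B : C.Ob n} {D : C.Ob k} {A : C.Ob (k + 1)}
    (h : C.ft A = D) (f : of X ⟶ of B) (u : of B ⟶ of A) :
    sec h (f ≫ u) = sec (C.ft_pb h _) (f ≫ graph h _ u rfl) := by
  rw [← sec_comp_q h (u ≫ C.p h), Category.assoc, graph_q]

/-- A morphism is its induced section followed by `q`, and `q` depends only on the projection. -/
theorem eq_of_sec_eq {n k : ℕ} {B : C.Ob n} {D : C.Ob k} {A : C.Ob (k + 1)} (h : C.ft A = D)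
    {u u' : of B ⟶ of A} (e : u ≫ C.p h = u' ≫ C.p h) (e' : sec h u = sec h u') : u = u' := by
  rw [← mk_graph_eq_sec h (u' ≫ C.p h) u e] at e'
  have h₁ : graph h (u' ≫ C.p h) u e = graph h (u' ≫ C.p h) u' rfl :=
    eq_of_heq (Sec.mk.inj e').2.2
  rw [← graph_q h _ u e, h₁, graph_q]

/-! ### Reindexing of types and terms -/

/-- The carriers of the model of a contextual category. -/
abbrev Carrier (C : CCat.{u}) : Kind × ℕ → Type u
  | (.ctx, n) => C.Ob n
  | (.tm, n) => C.Sec n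

/-- The context of a type or a term. -/
@[reducible]
def ctx {n : ℕ} : ∀ p : TmTy, C.Carrier (p.sort n) → C.Ob n
  | .tm, x => Sec.base x
  | .ty, A => C.ft (n := n) A

/-- The substitution of a morphism into a type or a term. -/
noncomputable def inst {n k : ℕ} {B : C.Ob n} {D : C.Ob k} :
    ∀ (p : TmTy) (x : C.Carrier (p.sort k)), ctx p x = D → (of B ⟶ of D) → C.Carrier (p.sort n)
  | .tm, x, h, f => sec (Sec.ft_ty x) (f ≫ eqToHom (congrArg of h.symm) ≫ Sec.hom x)
  | .ty, _, h, f => C.pb h f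

theorem ctx_inst {n k : ℕ} {B : C.Ob n} {D : C.Ob k} (p : TmTy) (x : C.Carrier (p.sort k))
    (h : ctx p x = D) (f : of B ⟶ of D) : ctx p (inst p x h f) = B := by
  cases p
  · rfl
  · exact C.ft_pb h f

theorem inst_tm {n k : ℕ} {B : C.Ob n} (x : C.Sec k) (f : of B ⟶ of x.base) :
    inst .tm x rfl f = sec x.ft_ty (f ≫ x.hom) := by
  change sec x.ft_ty (f ≫ 𝟙 (of x.base) ≫ x.hom) = _
  rw [Category.id_comp]

theorem inst_id {n : ℕ} {D : C.Ob n} (p : TmTy) (x : C.Carrier (p.sort n)) (h : ctx p x = D) :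
    inst p x h (𝟙 (of D)) = x := by
  subst h
  cases p
  · obtain ⟨D, A, h, s, hs⟩ := x
    refine (inst_tm _ _).trans ?_
    rw [Category.id_comp]
    exact sec_of_section _ _ hs
  · exact C.pb_id _

/-- For types this is functoriality of pullbacks; for terms it is `sec_comp`. It is the semantic
content of the iterated substitution axiom. -/
theorem inst_comp {m n k : ℕ} {X : C.Ob m} {B : C.Ob n} {D : C.Ob k} (p : TmTy)
    (x : C.Carrier (p.sort k)) (h : ctx p x = D) (f : of X ⟶ of B) (g : of B ⟶ of D) :
    inst p x h (f ≫ g) = inst p (inst p x h g) (ctx_inst p x h g) f := by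
  cases p
  · obtain ⟨D, A, h, s, hs⟩ := x
    subst h
    obtain rfl := h
    have e := inst_tm (⟨_, A, rfl, s, hs⟩ : C.Sec k) g
    refine (inst_tm _ _).trans ?_
    rw [Category.assoc, sec_comp]
    refine (inst_tm (sec rfl (g ≫ s)) f).symm.trans ?_
    congr 1
    exact e.symm
  · exact C.pb_comp _ f g

theorem ty_inst {n k : ℕ} {B : C.Ob n} {D : C.Ob k} (x : C.Sec k) (h : ctx .tm x = D)
    (h' : ctx .ty x.ty = D) (f : of B ⟶ of D) :
    Sec.ty (inst .tm x h f) = inst .ty x.ty h' f := by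
  obtain ⟨D, A, h, s, hs⟩ := x
  subst h
  obtain rfl := h
  refine (congrArg Sec.ty (inst_tm _ _)).trans ?_
  change C.pb rfl ((f ≫ s) ≫ C.p rfl) = C.pb rfl f
  rw [Category.assoc, hs, Category.comp_id]

/-! ### Morphisms as tuples of sections, and substitution -/

/-- The tuple of sections corresponding to a morphism. -/
noncomputable def comps {n : ℕ} {B : C.Ob n} :
    ∀ {k : ℕ} {A : C.Ob k}, (of B ⟶ of A) → Fin k → C.Sec n
  | 0, _, _ => Fin.elim0
  | _ + 1, A, f => Fin.snoc (α := fun _ => C.Sec n) (comps (f ≫ C.p (A := A) rfl)) (sec rfl f)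

theorem comps_castSucc {n k : ℕ} {B : C.Ob n} {A : C.Ob (k + 1)} {D : C.Ob k} (h : C.ft A = D)
    (f : of B ⟶ of A) (i : Fin k) : comps f i.castSucc = comps (f ≫ C.p h) i := by
  subst h
  exact Fin.snoc_castSucc (α := fun _ => C.Sec n) _ _ _

theorem comps_last {n k : ℕ} {B : C.Ob n} {A : C.Ob (k + 1)} {D : C.Ob k} (h : C.ft A = D)
    (f : of B ⟶ of A) : comps f (Fin.last k) = sec h f := by
  subst h
  exact Fin.snoc_last (α := fun _ => C.Sec n) _ _

/-- Terminality settles length zero; above it, `eq_of_sec_eq` recovers a morphism from its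
projection and its last section. This makes the choice in `subst` harmless. -/
theorem comps_injective {n k : ℕ} {B : C.Ob n} {A : C.Ob k} {f g : of B ⟶ of A}
    (h : comps f = comps g) : f = g := by
  induction k with
  | zero =>
    obtain rfl := C.eq_pt A
    obtain ⟨hu⟩ := C.terminal (of B)
    exact (hu.eq_default f).trans (hu.eq_default g).symm
  | succ k ih =>
    refine eq_of_sec_eq rfl (ih (funext fun i => ?_)) ?_
    · rw [← comps_castSucc, ← comps_castSucc, h]
    · rw [← comps_last, ← comps_last, h]

/-- The partial substitution operations. -/
noncomputable def subst (p : TmTy) {n k : ℕ} (B : C.Ob n) (x : C.Carrier (p.sort k)) (a : Fin k → C.Sec n) :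
    Part (C.Carrier (p.sort n)) where
  Dom := ∃ f : of B ⟶ of (ctx p x), comps f = a
  get h := inst p x rfl h.choose

theorem inst_mem_subst {p : TmTy} {n k : ℕ} {B : C.Ob n} {D : C.Ob k} {x : C.Carrier (p.sort k)}
    {a : Fin k → C.Sec n} (h : ctx p x = D) (f : of B ⟶ of D) (hf : comps f = a) :
    inst p x h f ∈ subst p B x a := by
  subst h
  have hd : ∃ f : of B ⟶ of (ctx p x), comps f = a := ⟨f, hf⟩
  refine ⟨hd, ?_⟩
  change inst p x rfl hd.choose = _
  rw [comps_injective (hd.choose_spec.trans hf.symm)]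

theorem mem_subst {p : TmTy} {n k : ℕ} {B : C.Ob n} {x : C.Carrier (p.sort k)}
    {a : Fin k → C.Sec n} {y : C.Carrier (p.sort n)} :
    y ∈ subst p B x a ↔ ∃ f : of B ⟶ of (ctx p x), comps f = a ∧ inst p x rfl f = y := by
  constructor
  · rintro ⟨h, rfl⟩
    exact ⟨h.choose, h.choose_spec, rfl⟩
  · rintro ⟨f, hf, rfl⟩
    exact inst_mem_subst rfl f hf

/-- Composition in `C` is componentwise substitution, as in `F` of a model. With `u` an identity it
yields the substitution rule for variables. -/
theorem comps_comp_mem {m n k : ℕ} {X : C.Ob m} {B : C.Ob n} {A : C.Ob k} (f : of X ⟶ of B)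
    (u : of B ⟶ of A) (i : Fin k) :
    comps (f ≫ u) i ∈ subst .tm (k := n) X (comps u i) (comps f) := by
  induction k with
  | zero => exact i.elim0
  | succ k ih =>
    refine Fin.lastCases ?_ (fun i => ?_) i
    · have h := inst_mem_subst (p := .tm) (x := sec rfl u) rfl f rfl
      rw [inst_tm (sec rfl u) f] at h
      rw [comps_last rfl, comps_last rfl, sec_comp]
      exact h
    · rw [comps_castSucc rfl, comps_castSucc rfl, Category.assoc]
      exact ih _ i

/-- Coming from a morphism obeys the same recursion on length as the formula `Hom`, so the two
conditions coincide. -/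
theorem exists_comps_eq_succ_iff {n k : ℕ} {B : C.Ob n} {A : C.Ob (k + 1)}
    {a : Fin (k + 1) → C.Sec n} : (∃ f : of B ⟶ of A, comps f = a) ↔
      (∃ f : of B ⟶ of (C.ft A), comps f = fun i => a i.castSucc) ∧
        (a (Fin.last k)).ty ∈ subst .ty (k := k) B A (fun i => a i.castSucc) := by
  constructor
  · rintro ⟨f, rfl⟩
    have e : comps (f ≫ C.p rfl) = fun i => comps f i.castSucc :=
      funext fun i => (comps_castSucc rfl f i).symm
    refine ⟨⟨_, e⟩, ?_⟩
    rw [comps_last rfl]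
    exact inst_mem_subst (p := .ty) rfl (f ≫ C.p rfl) e
  · rintro ⟨-, h⟩
    obtain ⟨g, hg, e⟩ : ∃ g : of B ⟶ of (C.ft A), (comps g = fun i => a i.castSucc) ∧
        C.pb rfl g = (a (Fin.last k)).ty := mem_subst.1 h
    generalize ht : a (Fin.last k) = t at e
    obtain ⟨D, T, hT, s, hs⟩ := t
    obtain rfl : C.pb rfl g = T := e
    obtain rfl : B = D := (C.ft_pb rfl g).symm.trans hT
    have e₁ : (s ≫ C.q rfl g) ≫ C.p rfl = g := by
      rw [Category.assoc, (C.isPullback rfl g).w, ← Category.assoc, hs, Category.id_comp]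
    -- The last term is a section of the pullback of `A` along `g`; following it by `q` gives a
    -- morphism to `A` over `g`.
    refine ⟨s ≫ C.q rfl g, funext fun i => Fin.lastCases ?_ (fun i => ?_) i⟩
    · rw [comps_last rfl, sec_comp_q, sec_of_section _ _ hs, ht]
    · rw [comps_castSucc rfl, e₁]
      exact congrFun hg i

/-- The interpretation of the signature of the theory of substitutions in a contextual category:
terms are sections of the canonical projections. -/
noncomputable abbrev interp (C : CCat.{u}) : Interpretation.{0, u} sig where
  carrier := C.Carrier
  fn
    | .star, _ => Part.some C.pt
    | .ft n, x => Part.some (C.ft (n := n) (x ()))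
    | .ty n, x => Part.some (Sec.ty (n := n) (x ()))
    | .v n i, x => Part.some (comps (𝟙 (of (x () : C.Ob n))) (Fin.rev i))
    | .subst p n k, x => subst p (n := n) (k := k) (x .base) (x .body) (fun i => x (.sub i))
  rel R := R.elim

/-- The derived operations `ftⁱ`. -/
def ftIter {n : ℕ} : ∀ i : ℕ, C.Ob (n + i) → C.Ob n
  | 0, A => A
  | i + 1, A => ftIter i (C.ft A)

/-- Composing with the `i` successive projections truncates the tuple. -/
theorem exists_comps_ftIter {m n : ℕ} {B : C.Ob m} (i : ℕ) {A : C.Ob (n + i)}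
    (f : of B ⟶ of A) : ∃ g : of B ⟶ of (ftIter i A), ∀ t : Fin n,
      comps g t = comps f (Fin.castLE (Nat.le_add_right n i) t) := by
  induction i with
  | zero => exact ⟨f, fun t => rfl⟩
  | succ i ih =>
    obtain ⟨g, hg⟩ := ih (f ≫ C.p rfl)
    exact ⟨g, fun t => (hg t).trans (comps_castSucc rfl f _).symm⟩

/-! ### Evaluation of terms and formulas in a contextual category -/

section Eval

variable {V : Vars sig.Srt} {ρ : ∀ x, C.interp.carrier (V.sort x)}

theorem eval_tStar : C.interp.eval ρ tStar = Part.some C.pt :=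
  C.interp.eval_app ρ Sym.star _ (fun i => i.elim) (fun i => i.elim)

theorem eval_tFt {n : ℕ} {t : Term sig V (.ctx, n + 1)} {A : C.Ob (n + 1)}
    (h : C.interp.eval ρ t = Part.some A) : C.interp.eval ρ (tFt t) = Part.some (C.ft A) :=
  C.interp.eval_app ρ (Sym.ft n) _ (fun _ => A) (fun _ => h)

theorem eval_tTy {n : ℕ} {t : Term sig V (.tm, n)} {a : C.Sec n}
    (h : C.interp.eval ρ t = Part.some a) : C.interp.eval ρ (tTy t) = Part.some a.ty :=
  C.interp.eval_app ρ (Sym.ty n) _ (fun _ => a) (fun _ => h)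

theorem eval_tV {n : ℕ} (i : Fin n) {t : Term sig V (.ctx, n)} {A : C.Ob n}
    (h : C.interp.eval ρ t = Part.some A) :
    C.interp.eval ρ (tV i t) = Part.some (comps (𝟙 (of A)) (Fin.rev i)) :=
  C.interp.eval_app ρ (Sym.v n i) _ (fun _ => A) (fun _ => h)

theorem eval_tVs {n : ℕ} (j : ℕ) (hj : j ≤ n) {t : Term sig V (.ctx, n)} {A : C.Ob n}
    (h : C.interp.eval ρ t = Part.some A) (i : Fin j) :
    C.interp.eval ρ (tVs j hj t i) = Part.some (comps (𝟙 (of A)) (Fin.castLE hj i)) := by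
  refine (eval_tV _ h).trans ?_
  rw [Fin.rev_rev]

theorem eval_tCtx {n : ℕ} (p : TmTy) {t : Term sig V (p.sort n)} {x : C.Carrier (p.sort n)}
    (h : C.interp.eval ρ t = Part.some x) : C.interp.eval ρ (tCtx p t) = Part.some (ctx p x) := by
  cases p
  · refine (eval_tFt (eval_tTy h)).trans ?_
    rw [Sec.ft_ty]
  · exact eval_tFt h

theorem eval_tFtIter {n : ℕ} (i : ℕ) {t : Term sig V (.ctx, n + i)} {A : C.Ob (n + i)}
    (h : C.interp.eval ρ t = Part.some A) :
    C.interp.eval ρ (tFtIter i t) = Part.some (ftIter i A) := by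
  induction i with
  | zero => exact h
  | succ i ih => exact ih (eval_tFt h)

theorem eval_tSubst (p : TmTy) {n k : ℕ} {tB : Term sig V (.ctx, n)} {tx : Term sig V (p.sort k)}
    {ta : Fin k → Term sig V (.tm, n)} {B : C.Ob n} {x : C.Carrier (p.sort k)}
    {a : Fin k → C.Sec n} (hB : C.interp.eval ρ tB = Part.some B)
    (hx : C.interp.eval ρ tx = Part.some x)
    (ha : ∀ i, C.interp.eval ρ (ta i) = Part.some (a i)) :
    C.interp.eval ρ (tSubst p tB tx ta) = subst p B x a :=
  C.interp.eval_app ρ (Sym.subst p n k) _ (args (X := C.Carrier) B x a) (fun i => match i with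
    | .base => hB
    | .body => hx
    | .sub i => ha i)

theorem sat_homFormula {n k : ℕ} {tB : Term sig V (.ctx, n)} {tA : Term sig V (.ctx, k)}
    {ta : Fin k → Term sig V (.tm, n)} {B : C.Ob n} {A : C.Ob k} {a : Fin k → C.Sec n}
    (hB : C.interp.eval ρ tB = Part.some B) (hA : C.interp.eval ρ tA = Part.some A)
    (ha : ∀ i, C.interp.eval ρ (ta i) = Part.some (a i)) :
    C.interp.Sat ρ (homFormula tB k tA ta) ↔ ∃ f : of B ⟶ of A, comps f = a := by
  induction k with
  | zero =>
    refine iff_of_true (C.interp.sat_nil _) ?_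
    obtain rfl := C.eq_pt A
    obtain ⟨⟨⟨f⟩, _⟩⟩ := C.terminal (of B)
    exact ⟨f, funext fun i => i.elim0⟩
  | succ k ih =>
    rw [homFormula, C.interp.sat_append, Interpretation.sat_eq, exists_comps_eq_succ_iff]
    refine and_congr (ih (eval_tFt hA) fun i => ha _) ?_
    rw [eval_tTy (ha _), eval_tSubst .ty hB hA (fun i => ha _)]
    simp [Part.mem_some_iff]

theorem sat_eq_of_mem {s : Kind × ℕ} {t₁ t₂ : Term sig V s} {y : C.Carrier s}
    (h₁ : y ∈ C.interp.eval ρ t₁) (h₂ : y ∈ C.interp.eval ρ t₂) : C.interp.Sat ρ [.eq t₁ t₂] :=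
  (C.interp.sat_eq _ _ _).2 ⟨y, h₁, h₂⟩

theorem mem_of_eq_some {s : Kind × ℕ} {t : Term sig V s} {y : C.Carrier s}
    (h : C.interp.eval ρ t = Part.some y) : y ∈ C.interp.eval ρ t := Part.eq_some_iff.1 h

end Eval

/-! ### Validity of the axioms -/

section Sat

variable {V : Vars sig.Srt} {ρ : ∀ x, C.interp.carrier (V.sort x)}

/-- Truncating the identity of `A` to length `j + 1` gives a morphism to `ftIter i A`; the typing
clause for its last component is the required equation. -/
theorem sat_ty_v {j i : ℕ} {t : Term sig V (.ctx, j + 1 + i)} {A : C.Ob (j + 1 + i)}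
    (hA : C.interp.eval ρ t = Part.some A) : C.interp.Sat ρ
      [.eq (tTy (tV ⟨i, by omega⟩ t)) (tSubst .ty t (tFtIter i t) (tVs j (by omega) t))] := by
  obtain ⟨g, hg⟩ := exists_comps_ftIter i (𝟙 (of A))
  -- Variables are numbered from the right: in a tuple of length `j + 1 + i`, index `i` from the
  -- right is index `j` from the left.
  have e : comps g (Fin.last j) = comps (𝟙 (of A)) (Fin.rev ⟨i, by omega⟩) := by
    rw [hg]
    congr 1
    ext
    simp
    omega
  refine sat_eq_of_mem (mem_of_eq_some (eval_tTy (eval_tV _ hA))) ?_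
  rw [eval_tSubst .ty hA (eval_tFtIter i hA) (eval_tVs _ _ hA), ← e]
  have := (exists_comps_eq_succ_iff.1 ⟨g, rfl⟩).2
  simp only [hg] at this ⊢
  exact this

theorem sat_subst_v {p : TmTy} {n : ℕ} {t : Term sig V (p.sort n)} {x : C.Carrier (p.sort n)}
    (hx : C.interp.eval ρ t = Part.some x) :
    C.interp.Sat ρ [.eq (tSubst p (tCtx p t) t (tVs n le_rfl (tCtx p t))) t] := by
  refine sat_eq_of_mem ?_ (mem_of_eq_some hx)
  rw [eval_tSubst p (eval_tCtx p hx) hx (eval_tVs n le_rfl (eval_tCtx p hx))]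
  have := inst_mem_subst (p := p) (x := x) rfl (𝟙 _) rfl
  rw [inst_id] at this
  exact this

theorem sat_defined_tSubst {p : TmTy} {n k : ℕ} {tB : Term sig V (.ctx, n)} {tx : Term sig V (p.sort k)}
    {ta : Fin k → Term sig V (.tm, n)} {B : C.Ob n} {x : C.Carrier (p.sort k)} {a : Fin k → C.Sec n}
    (hB : C.interp.eval ρ tB = Part.some B) (hx : C.interp.eval ρ tx = Part.some x)
    (ha : ∀ i, C.interp.eval ρ (ta i) = Part.some (a i))
    (h : C.interp.Sat ρ (homFormula tB k (tCtx p tx) ta)) :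
    C.interp.Sat ρ [.defined (tSubst p tB tx ta)] := by
  obtain ⟨f, hf⟩ := (sat_homFormula hB (eval_tCtx p hx) ha).1 h
  have hm := inst_mem_subst (p := p) rfl f hf
  rw [← eval_tSubst p hB hx ha] at hm
  exact sat_eq_of_mem hm hm

theorem sat_homFormula_of_defined {p : TmTy} {n k : ℕ} {tB : Term sig V (.ctx, n)} {tx : Term sig V (p.sort k)}
    {ta : Fin k → Term sig V (.tm, n)} {B : C.Ob n} {x : C.Carrier (p.sort k)} {a : Fin k → C.Sec n}
    (hB : C.interp.eval ρ tB = Part.some B) (hx : C.interp.eval ρ tx = Part.some x)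
    (ha : ∀ i, C.interp.eval ρ (ta i) = Part.some (a i))
    (h : C.interp.Sat ρ [.defined (tSubst p tB tx ta)]) :
    C.interp.Sat ρ (homFormula tB k (tCtx p tx) ta) := by
  obtain ⟨y, hy, -⟩ := (C.interp.sat_eq _ _ _).1 h
  rw [eval_tSubst p hB hx ha] at hy
  obtain ⟨f, hf, -⟩ := mem_subst.1 hy
  exact (sat_homFormula hB (eval_tCtx p hx) ha).2 ⟨f, hf⟩

theorem sat_ft_subst {n k : ℕ} {tB : Term sig V (.ctx, n)} {tx : Term sig V (.ctx, k + 1)}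
    {ta : Fin k → Term sig V (.tm, n)} {B : C.Ob n} {x : C.Ob (k + 1)} {a : Fin k → C.Sec n}
    (hB : C.interp.eval ρ tB = Part.some B) (hx : C.interp.eval ρ tx = Part.some x)
    (ha : ∀ i, C.interp.eval ρ (ta i) = Part.some (a i))
    (h : C.interp.Sat ρ (homFormula tB k (tFt tx) ta)) :
    C.interp.Sat ρ [.eq (tFt (tSubst .ty tB tx ta)) tB] := by
  obtain ⟨f, hf⟩ := (sat_homFormula hB (eval_tFt hx) ha).1 h
  have hm := inst_mem_subst (p := .ty) (x := x) rfl f hf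
  rw [← eval_tSubst .ty hB hx ha] at hm
  refine sat_eq_of_mem (y := B) ?_ (mem_of_eq_some hB)
  rw [eval_tFt (Part.eq_some_iff.2 hm)]
  exact Part.mem_some_iff.2 (C.ft_pb rfl f).symm

/-- Definedness of either side amounts to a morphism into the context of `x`, so this serves both
halves of the Kleene equality. -/
theorem sat_ty_subst {n k : ℕ} {tB : Term sig V (.ctx, n)} {tx : Term sig V (.tm, k)}
    {ta : Fin k → Term sig V (.tm, n)} {B : C.Ob n} {x : C.Sec k} {a : Fin k → C.Sec n}
    (hB : C.interp.eval ρ tB = Part.some B) (hx : C.interp.eval ρ tx = Part.some x)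
    (ha : ∀ i, C.interp.eval ρ (ta i) = Part.some (a i))
    (h : ∃ f : of B ⟶ of x.base, comps f = a) :
    C.interp.Sat ρ [.eq (tTy (tSubst .tm tB tx ta)) (tSubst .ty tB (tTy tx) ta)] := by
  obtain ⟨f, hf⟩ := h
  have hm := inst_mem_subst (p := .tm) (x := x) rfl f hf
  rw [← eval_tSubst .tm hB hx ha] at hm
  refine sat_eq_of_mem (mem_of_eq_some (eval_tTy (Part.eq_some_iff.2 hm))) ?_
  rw [eval_tSubst .ty hB (eval_tTy hx) ha, ty_inst x rfl x.ft_ty]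
  exact inst_mem_subst (p := .ty) x.ft_ty f hf

theorem sat_ty_subst_of_defined {n k : ℕ} {tB : Term sig V (.ctx, n)} {tx : Term sig V (.tm, k)}
    {ta : Fin k → Term sig V (.tm, n)} {B : C.Ob n} {x : C.Sec k} {a : Fin k → C.Sec n}
    (hB : C.interp.eval ρ tB = Part.some B) (hx : C.interp.eval ρ tx = Part.some x)
    (ha : ∀ i, C.interp.eval ρ (ta i) = Part.some (a i))
    (h : C.interp.Sat ρ [.defined (tTy (tSubst .tm tB tx ta))]) :
    C.interp.Sat ρ [.eq (tTy (tSubst .tm tB tx ta)) (tSubst .ty tB (tTy tx) ta)] := by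
  obtain ⟨y, hy, -⟩ := (C.interp.sat_eq _ _ _).1 h
  obtain ⟨z, hz, -⟩ := (C.interp.mem_eval_app _ _ _ _).1 hy
  have hz' : z () ∈ C.interp.eval ρ (tSubst .tm tB tx ta) := hz ()
  rw [eval_tSubst .tm hB hx ha] at hz'
  obtain ⟨f, hf, -⟩ := mem_subst.1 hz'
  exact sat_ty_subst hB hx ha ⟨f, hf⟩

theorem sat_subst_ty_of_defined {n k : ℕ} {tB : Term sig V (.ctx, n)} {tx : Term sig V (.tm, k)}
    {ta : Fin k → Term sig V (.tm, n)} {B : C.Ob n} {x : C.Sec k} {a : Fin k → C.Sec n}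
    (hB : C.interp.eval ρ tB = Part.some B) (hx : C.interp.eval ρ tx = Part.some x)
    (ha : ∀ i, C.interp.eval ρ (ta i) = Part.some (a i))
    (h : C.interp.Sat ρ [.defined (tSubst .ty tB (tTy tx) ta)]) :
    C.interp.Sat ρ [.eq (tTy (tSubst .tm tB tx ta)) (tSubst .ty tB (tTy tx) ta)] := by
  obtain ⟨y, hy, -⟩ := (C.interp.sat_eq _ _ _).1 h
  rw [eval_tSubst .ty hB (eval_tTy hx) ha] at hy
  have hd : ∃ f : of B ⟶ of (C.ft x.ty), comps f = a := hy.1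
  rw [x.ft_ty] at hd
  exact sat_ty_subst hB hx ha hd

theorem sat_v_subst {n k : ℕ} (i : Fin k) {tB : Term sig V (.ctx, n)} {tx : Term sig V (.ctx, k)}
    {ta : Fin k → Term sig V (.tm, n)} {B : C.Ob n} {x : C.Ob k} {a : Fin k → C.Sec n}
    (hB : C.interp.eval ρ tB = Part.some B) (hx : C.interp.eval ρ tx = Part.some x)
    (ha : ∀ i, C.interp.eval ρ (ta i) = Part.some (a i))
    (h : C.interp.Sat ρ (homFormula tB k tx ta)) :
    C.interp.Sat ρ [.eq (tSubst .tm tB (tV i tx) ta) (ta (Fin.rev i))] := by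
  obtain ⟨f, rfl⟩ := (sat_homFormula hB hx ha).1 h
  refine sat_eq_of_mem ?_ (mem_of_eq_some (ha _))
  rw [eval_tSubst .tm hB (eval_tV i hx) ha]
  have := comps_comp_mem f (𝟙 _) (Fin.rev i)
  rwa [Category.comp_id] at this

theorem sat_subst_subst {p : TmTy} {n k m : ℕ} {tC : Term sig V (.ctx, n)}
    {tb : Fin k → Term sig V (.tm, n)} {tB : Term sig V (.ctx, k)}
    {ta : Fin m → Term sig V (.tm, k)} {tx : Term sig V (p.sort m)} {X : C.Ob n}
    {b : Fin k → C.Sec n} {B : C.Ob k} {a : Fin m → C.Sec k} {x : C.Carrier (p.sort m)}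
    (hC : C.interp.eval ρ tC = Part.some X)
    (hb : ∀ i, C.interp.eval ρ (tb i) = Part.some (b i))
    (hB : C.interp.eval ρ tB = Part.some B)
    (ha : ∀ i, C.interp.eval ρ (ta i) = Part.some (a i))
    (hx : C.interp.eval ρ tx = Part.some x) (h₁ : C.interp.Sat ρ (homFormula tC k tB tb))
    (h₂ : C.interp.Sat ρ (homFormula tB m (tCtx p tx) ta)) :
    C.interp.Sat ρ [.eq (tSubst p tC (tSubst p tB tx ta) tb)
      (tSubst p tC tx (fun i => tSubst .tm tC (ta i) tb))] := by
  obtain ⟨f, rfl⟩ := (sat_homFormula hC hB hb).1 h₁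
  obtain ⟨g, rfl⟩ := (sat_homFormula hB (eval_tCtx p hx) ha).1 h₂
  have hy := inst_mem_subst (p := p) rfl g rfl
  rw [← eval_tSubst p hB hx ha] at hy
  have hd (i : Fin m) : C.interp.eval ρ (tSubst .tm tC (ta i) tb) =
      Part.some (comps (f ≫ g) i) := by
    rw [eval_tSubst .tm hC (ha i) hb]
    exact Part.eq_some_iff.2 (comps_comp_mem f g i)
  refine sat_eq_of_mem (y := inst p x rfl (f ≫ g)) ?_ ?_
  -- Both sides are the reindexing of `x` along `f ≫ g`: here in two stages, below in one.
  · rw [eval_tSubst p hC (Part.eq_some_iff.2 hy) hb, inst_comp]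
    exact inst_mem_subst _ f rfl
  · rw [eval_tSubst p hC hx hd]
    exact inst_mem_subst rfl (f ≫ g) rfl

end Sat

section Axioms

theorem eval_var₁ {s : Kind × ℕ} (ρ : Unit → C.Carrier s) :
    C.interp.eval (V := oneVar s) ρ var₁ = Part.some (ρ ()) :=
  C.interp.eval_var (V := oneVar s) ρ ()

section

variable {s : Kind × ℕ} {n k : ℕ} (ρ : ∀ i : Pos k, C.Carrier (Pos.sort s n k i))

theorem eval_varB : C.interp.eval (V := tupleVars s n k) ρ varB = Part.some (ρ .base) :=
  C.interp.eval_var (V := tupleVars s n k) ρ .base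

theorem eval_varX : C.interp.eval (V := tupleVars s n k) ρ varX = Part.some (ρ .body) :=
  C.interp.eval_var (V := tupleVars s n k) ρ .body

theorem eval_varA (i : Fin k) :
    C.interp.eval (V := tupleVars s n k) ρ (varA i) = Part.some (ρ (.sub i)) :=
  C.interp.eval_var (V := tupleVars s n k) ρ (.sub i)

end

theorem holds_ax (C : CCat.{u}) (S : Sequent sig) (hS : Ax S) : C.interp.Holds S := by
  intro ρ h
  cases hS with
  | star_def => exact sat_eq_of_mem (mem_of_eq_some eval_tStar) (mem_of_eq_some eval_tStar)
  | star_unique =>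
    refine sat_eq_of_mem (mem_of_eq_some (eval_var₁ (C := C) (s := (.ctx, 0)) ρ))
      (mem_of_eq_some ?_)
    exact eval_tStar.trans (congrArg Part.some (C.eq_pt (ρ ())).symm)
  | v_def n i =>
    exact sat_eq_of_mem (mem_of_eq_some (eval_tV i (eval_var₁ (C := C) (s := (.ctx, n)) ρ)))
      (mem_of_eq_some (eval_tV i (eval_var₁ (C := C) (s := (.ctx, n)) ρ)))
  | subst_def p n k =>
    exact sat_defined_tSubst (eval_varB (C := C) ρ) (eval_varX (C := C) ρ)
      (eval_varA (C := C) ρ) h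
  | def_subst p n k =>
    exact sat_homFormula_of_defined (eval_varB (C := C) ρ) (eval_varX (C := C) ρ)
      (eval_varA (C := C) ρ) h
  | ty_v j i => exact sat_ty_v (eval_var₁ (C := C) (s := (.ctx, j + 1 + i)) ρ)
  | ft_subst n k =>
    exact sat_ft_subst (eval_varB (C := C) ρ) (eval_varX (C := C) ρ) (eval_varA (C := C) ρ) h
  | ty_subst n k =>
    exact sat_ty_subst_of_defined (eval_varB (C := C) ρ) (eval_varX (C := C) ρ)
      (eval_varA (C := C) ρ) h
  | subst_ty n k =>
    exact sat_subst_ty_of_defined (eval_varB (C := C) ρ) (eval_varX (C := C) ρ)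
      (eval_varA (C := C) ρ) h
  | subst_v p n => exact sat_subst_v (eval_var₁ (C := C) ρ)
  | v_subst n k i =>
    exact sat_v_subst i (eval_varB (C := C) ρ) (eval_varX (C := C) ρ) (eval_varA (C := C) ρ) h
  | subst_subst p n k m =>
    obtain ⟨h₁, h₂⟩ := (C.interp.sat_append _ _ _).1 h
    exact sat_subst_subst (C.interp.eval_var (V := compVars p n k m) ρ .C)
      (fun i => C.interp.eval_var (V := compVars p n k m) ρ (.b i))
      (C.interp.eval_var (V := compVars p n k m) ρ .B)
      (fun i => C.interp.eval_var (V := compVars p n k m) ρ (.a i))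
      (C.interp.eval_var (V := compVars p n k m) ρ .x) h₁ h₂

end Axioms

end CCat

/-! ### Comparison of a contextual category with that of its model -/

namespace CCat

open GradedObj PartialHorn SubstTheory

/-- The model of the theory of substitutions in a contextual category. -/
noncomputable abbrev toModel (C : CCat.{u}) : Model.{0, u} 𝕊 where
  toInterpretation := C.interp
  holds := C.holds_ax

variable {C : CCat.{u}}

theorem vs_toModel {n : ℕ} (j : ℕ) (hj : j ≤ n) (A : C.Ob n) :
    vs (M := C.toModel) j hj A = fun i => comps (𝟙 (of A)) (Fin.castLE hj i) :=
  funext fun _ => congrArg (comps (𝟙 (of A))) (Fin.rev_rev _)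

theorem isHom_toModel_iff {n k : ℕ} {B : C.Ob n} {A : C.Ob k} {a : Fin k → C.Sec n} :
    IsHom (M := C.toModel) B A a ↔ ∃ f : of B ⟶ of A, comps f = a := by
  induction k with
  | zero =>
    refine iff_of_true trivial ?_
    obtain rfl := C.eq_pt A
    obtain ⟨⟨⟨f⟩, _⟩⟩ := C.terminal (of B)
    exact ⟨f, funext fun i => i.elim0⟩
  | succ k ih =>
    rw [exists_comps_eq_succ_iff]
    -- The operations `ft`, `ty` and `sub` of the model unfold to those of `C`, so the typing
    -- clauses coincide by definition.
    exact and_congr ih Iff.rfl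

/-- The morphism of `F(M)` given by a morphism of `C`, where `M` is the model of `C`. -/
noncomputable def homOfHom {n k : ℕ} {A : C.Ob n} {B : C.Ob k} (f : of A ⟶ of B) :
    of (Ob := SubstTheory.Ob C.toModel) A ⟶ of (Ob := SubstTheory.Ob C.toModel) B :=
  ⟨comps f, isHom_toModel_iff.2 ⟨f, rfl⟩⟩

theorem homOfHom_injective {n k : ℕ} {A : C.Ob n} {B : C.Ob k} :
    Function.Injective (homOfHom (A := A) (B := B)) := fun _ _ h =>
  comps_injective (congrArg Subtype.val h)

theorem homOfHom_surjective {n k : ℕ} {A : C.Ob n} {B : C.Ob k} :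
    Function.Surjective (homOfHom (A := A) (B := B)) := fun f => by
  obtain ⟨g, hg⟩ := isHom_toModel_iff.1 f.2
  exact ⟨g, Subtype.ext hg⟩

theorem homOfHom_id {n : ℕ} (A : C.Ob n) : homOfHom (𝟙 (of A)) = 𝟙 _ :=
  Subtype.ext (vs_toModel n le_rfl A).symm

theorem homOfHom_comp {n k m : ℕ} {A : C.Ob n} {B : C.Ob k} {E : C.Ob m} (f : of A ⟶ of B)
    (g : of B ⟶ of E) : homOfHom (f ≫ g) = homOfHom f ≫ homOfHom g :=
  Subtype.ext (comp_eq (homOfHom f).2 (homOfHom g).2 (comps_comp_mem f g)).symm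

theorem homOfHom_p {n : ℕ} {A : C.Ob (n + 1)} {B : C.Ob n} (h : C.ft A = B)
    (h' : SubstTheory.ft (M := C.toModel) A = B) : homOfHom (C.p h) = proj h' := by
  refine Subtype.ext (Eq.trans ?_ (vs_toModel n (Nat.le_succ n) A).symm)
  funext i
  refine Eq.trans ?_ (comps_castSucc h (𝟙 (of A)) i).symm
  rw [Category.id_comp]
  rfl

section

variable {n k : ℕ} {B : C.Ob n} {D : C.Ob k} {A : C.Ob (k + 1)} (h : C.ft A = D)
  (h' : SubstTheory.ft (M := C.toModel) A = D)

theorem pb_toModel (f : of B ⟶ of D) : C.pb h f = SubstTheory.pb h' (homOfHom f) :=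
  Part.mem_unique (inst_mem_subst (p := .ty) h f rfl) (SubstTheory.pb_mem h' (homOfHom f))

/-- The projections agree by the pullback square. For the last components, `sec_comp_q` at the
identity says that `q` and the identity of the pullback induce the same section, which is the
variable `v 0`. -/
theorem homOfHom_q (f : of B ⟶ of D) : homOfHom (C.q h f) =
    eqToHom (congrArg (of (Ob := SubstTheory.Ob C.toModel)) (pb_toModel h h' f)) ≫
      SubstTheory.q h' (homOfHom f) := by
  refine hom_ext h' ?_ ?_
  · rw [Category.assoc, q_proj, ← Category.assoc, eqToHom_proj (pb_toModel h h' f),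
      ← homOfHom_p h h', ← homOfHom_comp, (C.isPullback h f).w, homOfHom_comp,
      homOfHom_p (C.ft_pb h f)]
  · rw [eqToHom_comp_val (pb_toModel h h' f), q_last, ← pb_toModel h h' f]
    have e := sec_comp_q h f (𝟙 _)
    rw [Category.id_comp] at e
    exact (comps_last h _).trans (e.trans (comps_last (C.ft_pb h f) _).symm)

end

/-- The comparison morphism from a contextual category to the one of its model. -/
noncomputable def toFObj (C : CCat.{u}) : C ⟶ FObj C.toModel where
  obj A := A
  map f := homOfHom f
  map_id A := homOfHom_id A
  map_comp f g := homOfHom_comp f g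
  obj_ft h := h
  map_p h := homOfHom_p h h
  obj_pb h f := pb_toModel h h f
  map_q h f := homOfHom_q h h f

/-- The morphism of `C` given by a morphism of `F(M)`, where `M` is the model of `C`. -/
noncomputable def homOfFObj {n k : ℕ} {A : C.Ob n} {B : C.Ob k}
    (f : of (Ob := SubstTheory.Ob C.toModel) A ⟶ of (Ob := SubstTheory.Ob C.toModel) B) :
    of A ⟶ of B := (homOfHom_surjective f).choose

theorem homOfHom_homOfFObj {n k : ℕ} {A : C.Ob n} {B : C.Ob k}
    (f : of (Ob := SubstTheory.Ob C.toModel) A ⟶ of (Ob := SubstTheory.Ob C.toModel) B) :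
    homOfHom (homOfFObj f) = f := (homOfHom_surjective f).choose_spec

theorem homOfFObj_homOfHom {n k : ℕ} {A : C.Ob n} {B : C.Ob k} (f : of A ⟶ of B) :
    homOfFObj (homOfHom f) = f := homOfHom_injective (homOfHom_homOfFObj _)

theorem homOfFObj_comp {n k m : ℕ} {A : C.Ob n} {B : C.Ob k} {E : C.Ob m}
    (f : of (Ob := SubstTheory.Ob C.toModel) A ⟶ of (Ob := SubstTheory.Ob C.toModel) B)
    (g : of (Ob := SubstTheory.Ob C.toModel) B ⟶ of (Ob := SubstTheory.Ob C.toModel) E) :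
    homOfFObj (f ≫ g) = homOfFObj f ≫ homOfFObj g :=
  homOfHom_injective <| by
    rw [homOfHom_comp, homOfHom_homOfFObj, homOfHom_homOfFObj, homOfHom_homOfFObj]

section

variable {n k : ℕ} {B : C.Ob n} {D : C.Ob k} {A : C.Ob (k + 1)} (h : C.ft A = D)
  (h' : SubstTheory.ft (M := C.toModel) A = D)
  (f : of (Ob := SubstTheory.Ob C.toModel) B ⟶ of (Ob := SubstTheory.Ob C.toModel) D)

theorem pb_homOfFObj : SubstTheory.pb h' f = C.pb h (homOfFObj f) := by
  rw [pb_toModel h h', homOfHom_homOfFObj]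

/-- Taking `g` as a variable allows `f` to be replaced by `homOfHom g`, which reduces the claim to
`homOfHom_q` and injectivity. -/
theorem homOfFObj_q_of_eq (g : of B ⟶ of D) (hg : homOfHom g = f)
    (e : SubstTheory.pb h' f = C.pb h g) :
    homOfFObj (SubstTheory.q h' f) = eqToHom (congrArg (of (Ob := C.Ob)) e) ≫ C.q h g := by
  subst hg
  have e' : homOfHom (eqToHom (congrArg (of (Ob := C.Ob)) e)) =
      eqToHom (congrArg (of (Ob := SubstTheory.Ob C.toModel)) e) := C.toFObj.map_eqToHom e
  refine homOfHom_injective ?_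
  rw [homOfHom_homOfFObj, homOfHom_comp, e', homOfHom_q h h', eqToHom_trans_assoc, eqToHom_refl,
    Category.id_comp]

theorem homOfFObj_q : homOfFObj (SubstTheory.q h' f) =
    eqToHom (congrArg (of (Ob := C.Ob)) (pb_homOfFObj h h' f)) ≫ C.q h (homOfFObj f) :=
  homOfFObj_q_of_eq h h' f _ (homOfHom_homOfFObj f) (pb_homOfFObj h h' f)

end

/-- The inverse of the comparison morphism. -/
noncomputable def ofFObj (C : CCat.{u}) : FObj C.toModel ⟶ C where
  obj A := A
  map f := homOfFObj f
  map_id A := (congrArg homOfFObj (homOfHom_id (C := C) A).symm).trans (homOfFObj_homOfHom _)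
  map_comp f g := homOfFObj_comp (C := C) f g
  obj_ft h := h
  map_p h := (congrArg homOfFObj (homOfHom_p (C := C) h h).symm).trans (homOfFObj_homOfHom _)
  obj_pb h f := pb_homOfFObj (C := C) h h f
  map_q h f := homOfFObj_q (C := C) h h f

/-- A contextual category is isomorphic to the one of its model. -/
noncomputable def isoFObj (C : CCat.{u}) : FObj C.toModel ≅ C where
  hom := C.ofFObj
  inv := C.toFObj
  hom_inv_id := by
    refine CCat.Hom.ext rfl (heq_of_eq ?_)
    funext n k A B f
    exact homOfHom_homOfFObj (C := C) f
  inv_hom_id := by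
    refine CCat.Hom.ext rfl (heq_of_eq ?_)
    funext n k A B f
    exact homOfFObj_homOfHom (C := C) f

end CCat

/-! ### The equivalence -/

namespace SubstTheory

open PartialHorn

instance functorF_full : functorF.{u}.Full where
  map_surjective G := ⟨preimage G, FMap_preimage G⟩

instance functorF_faithful : functorF.{u}.Faithful where
  map_injective h := FMap_injective h

instance functorF_essSurj : functorF.{u}.EssSurj where
  mem_essImage C := ⟨C.toModel, ⟨C.isoFObj⟩⟩

instance functorF_isEquivalence : functorF.{u}.IsEquivalence where

end SubstTheory

theorem mainTheorem1 :
    ∃ map : ∀ {M N : PartialHorn.Model.{0, u} SubstTheory.𝕊},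
        (M ⟶ N) → (SubstTheory.FObj M ⟶ SubstTheory.FObj N),
      (∀ {M N : PartialHorn.Model.{0, u} SubstTheory.𝕊} (α : M ⟶ N) {n : ℕ}
        (A : SubstTheory.Ob M n), (map α).obj A = α.app (.ctx, n) A) ∧
      (∀ {M N : PartialHorn.Model.{0, u} SubstTheory.𝕊} (α : M ⟶ N) {n k : ℕ}
        {A : (SubstTheory.FObj M).Ob n} {B : (SubstTheory.FObj M).Ob k}
        (f : GradedObj.of A ⟶ GradedObj.of B) (i : Fin k),
        SubstTheory.components ((map α).map f) i =
          α.app (.tm, n) (SubstTheory.components f i)) ∧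
      ∃ (map_id : ∀ M : PartialHorn.Model.{0, u} SubstTheory.𝕊,
          map (𝟙 M) = 𝟙 (SubstTheory.FObj M))
        (map_comp : ∀ {M N K : PartialHorn.Model.{0, u} SubstTheory.𝕊} (α : M ⟶ N) (β : N ⟶ K),
          map (α ≫ β) = map α ≫ map β),
        Functor.IsEquivalence
          (C := PartialHorn.Model.{0, u} SubstTheory.𝕊) (D := CCat.{u})
          { obj := SubstTheory.FObj
            map := map
            map_id := map_id
            map_comp := map_comp } := by
  -- `FMap` applies `α` to objects and to components by definition, and the functor assembled from
  -- it is definitionally `functorF`.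
  exact ⟨SubstTheory.FMap, fun _ _ _ => rfl, fun _ _ _ _ _ _ _ => rfl, fun _ => rfl,
    fun _ _ => rfl, SubstTheory.functorF_isEquivalence⟩
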